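/- Let $\overleftrightarrow{K}_n$ be the complete digraph on $n$ vertices: it has no loops, and for any two distinct vertices $x,y$ both arcs $xy$ and $yx$ are present. For a digraph $D$ and a set $S\subseteq V(D)$ of at least two vertices, let $\lambda_S(D)$ be the maximum number of pairwise arc-disjoint strongly connected subgraphs of $D$ each of which contains all vertices of $S$ (the subgraphs need not be induced or spanning). For an integer $k$ with $2\le k\le |V(D)|$, the strong subgraph $k$-arc-connectivity of $D$ is $$\lambda_k(D)=\min\{\lambda_S(D)\mid S\subseteq V(D),\ |S|=k\}.$$ Then for all integers $2\le k\le n$, $$\lambda_k(\overleftrightarrow{K}_n)=\begin{cases} n-1, & \text{if } k\notin\{4,6\},\text{ or } k\in\{4,6\}\text{ and } k<n;\\ n-2, & \text{if } k=n\in\{4,6\}.\end{cases}$$ -/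

import Mathlib

namespace Digraph

/-- A subgraph of a digraph `D`: a set of vertices together with a set of arcs of `D`
whose end-vertices lie in that set of vertices. -/
@[ext]
structure Subdigraph {V : Type*} (D : Digraph V) where
  /-- The vertex set of the subgraph. -/
  verts : Set V
  /-- The arc relation of the subgraph. -/
  Adj : V → V → Prop
  /-- Every arc of the subgraph is an arc of `D`. -/
  adj_sub : ∀ {u v : V}, Adj u v → D.Adj u v
  /-- The tail of an arc is a vertex of the subgraph. -/
  tail_mem : ∀ {u v : V}, Adj u v → u ∈ verts
  /-- The head of an arc is a vertex of the subgraph. -/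
  head_mem : ∀ {u v : V}, Adj u v → v ∈ verts

/-- The set of arcs of a subgraph, an arc `uv` being the ordered pair `(u, v)`. -/
def Subdigraph.arcs {V : Type*} {D : Digraph V} (H : D.Subdigraph) : Set (V × V) :=
  {e | H.Adj e.1 e.2}

/-- A subgraph is strong (strongly connected) if any vertex of it can be reached from any other
one along a directed walk of arcs of the subgraph. -/
def Subdigraph.Strong {V : Type*} {D : Digraph V} (H : D.Subdigraph) : Prop :=
  H.verts.Nonempty ∧ ∀ u ∈ H.verts, ∀ v ∈ H.verts, Relation.ReflTransGen H.Adj u v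

/-- `D` has `p` pairwise arc-disjoint strong subgraphs, each of which contains `S`.
When `S` has at least two vertices a strong subgraph containing `S` has an arc, so that
arc-disjoint ones are automatically distinct. -/
def HasArcDisjointStrong {V : Type*} (D : Digraph V) (S : Finset V) (p : ℕ) : Prop :=
  ∃ H : Fin p → D.Subdigraph,
    (∀ i, (H i).Strong ∧ (S : Set V) ⊆ (H i).verts) ∧
    ∀ i j, i ≠ j → Disjoint (H i).arcs (H j).arcs

/-- `λ_S(D)`: the maximum number of arc-disjoint strong subgraphs of `D` that contain `S`,
as an extended natural number. A finite supremum of natural numbers is attained. -/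
noncomputable def localStrongArcConn {V : Type*} (D : Digraph V) (S : Finset V) : ℕ∞ :=
  ⨆ (p : ℕ) (_ : D.HasArcDisjointStrong S p), (p : ℕ∞)

/-- The strong subgraph `k`-arc-connectivity `λ_k(D)`: the minimum of `λ_S(D)` over all
sets `S` of exactly `k` vertices. -/
noncomputable def strongArcConn {V : Type*} (D : Digraph V) (k : ℕ) : ℕ∞ :=
  ⨅ (S : Finset V) (_ : S.card = k), D.localStrongArcConn S

/-- The complete digraph without loops on `V`: both arcs `xy` and `yx` are present for any two
distinct vertices `x` and `y`. (Mathlib's `Digraph.completeDigraph` has loops as well.) -/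
def symmComplete (V : Type*) : Digraph V where
  Adj x y := x ≠ y

end Digraph

/-! For the upper bound `n - 1`, fix a vertex of `S`: it has `n - 1` out-arcs, and each strong
subgraph containing `S` uses at least one of them. For the lower bound it suffices to split all arcs
into `n - 1` hamiltonian cycles, written as cyclic maps that never agree at a vertex
(`IsCyclicFactorization`).

For odd `n = 2m + 1` the zigzag on the residues modulo `2m` and infinity has pairwise distinct
differences, so its `2m` translates are arc-disjoint (`isCyclicFactorization_evenZigzag`). If `n ≥
4` is even and `S` misses a vertex `v`, this decomposition of the other `n - 1` vertices yields `n -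
2` cycles, and the star at `v` is one more subgraph.

For even `n = 2M + 2 ≥ 8`, take the residues modulo `2M + 1` and infinity with the perfect matchings
`x ↔ s - x`. An arc lies in exactly one matching, so a map is encoded by the number of the matching
it follows at each vertex, and disjointness means distinct numbers. Matchings `2r` and `2r + 1` form
a hamiltonian cycle, usable in both directions. Pairing up all matchings leaves one over, which only
gives `n - 2` cycles. Tillson's decomposition instead sets five matchings `-2, …, 2` aside and
recombines them into five directed cycles by explicit tables (`cyclicMap_centralMap`); the remaining
`2M - 4` matchings are paired (`isCyclicFactorization_tillson`).

For `k = n ∈ {4, 6}` the value `n - 2` comes from the paired matchings. Were there `n - 1`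
subgraphs, each would have out-degree one everywhere and so be a hamiltonian cycle
(`exists_factorization`); a finite search excludes such decompositions. -/

/-! ### Cyclic maps -/

/-- A self-map whose functional graph is strongly connected. -/
def CyclicMap {V : Type*} (f : V → V) : Prop := ∀ u v, ∃ k : ℕ, f^[k] u = v

/-- A family of cyclic maps no two of which agree anywhere. -/
def IsCyclicFactorization {ι V : Type*} (f : ι → V → V) : Prop :=
  (∀ i, CyclicMap (f i)) ∧ ∀ v, Function.Injective fun i => f i v

/-- The point `o` reaches its own preimage, so it is periodic and its orbit is a closed cycle
through every point. -/
theorem CyclicMap.of_forall_reach {V : Type*} {f : V → V} (o : V)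
    (h : ∀ v, ∃ k : ℕ, f^[k] o = v) (ho : ∃ y, f y = o) : CyclicMap f := by
  obtain ⟨y, hy⟩ := ho
  obtain ⟨d, rfl⟩ := h y
  rw [← Function.iterate_succ_apply' f] at hy
  have hper : ∀ t : ℕ, f^[(d + 1) * t] o = o := by
    intro t
    rw [Function.iterate_mul]
    exact Function.iterate_fixed hy t
  intro u v
  obtain ⟨a, rfl⟩ := h u
  obtain ⟨b, rfl⟩ := h v
  -- From position `a` of the orbit, `d * a` further steps complete `a` full turns of length `d +
  -- 1`.
  refine ⟨b + d * a, ?_⟩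
  rw [← Function.iterate_add_apply, show b + d * a + a = b + (d + 1) * a by ring,
    Function.iterate_add_apply, hper]

theorem CyclicMap.conj {V W : Type*} {f : V → V} (hf : CyclicMap f) (e : V ≃ W) :
    CyclicMap fun w => e (f (e.symm w)) := by
  intro u v
  obtain ⟨k, hk⟩ := hf (e.symm u) (e.symm v)
  refine ⟨k, ?_⟩
  have : ∀ k : ℕ, (fun w => e (f (e.symm w)))^[k] u = e (f^[k] (e.symm u)) := by
    intro k
    induction k with
    | zero => simp
    | succ k ih => rw [Function.iterate_succ_apply', ih, Function.iterate_succ_apply']; simp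
  rw [this, hk, e.apply_symm_apply]

theorem CyclicMap.apply_ne {V : Type*} [Nontrivial V] {f : V → V} (hf : CyclicMap f) (v : V) :
    f v ≠ v := by
  intro h
  obtain ⟨w, hw⟩ := exists_ne v
  obtain ⟨k, hk⟩ := hf v w
  rw [Function.iterate_fixed h] at hk
  exact hw hk.symm

theorem IsCyclicFactorization.conj {ι V W : Type*} {f : ι → V → V}
    (hf : IsCyclicFactorization f) (e : V ≃ W) :
    IsCyclicFactorization fun i w => e (f i (e.symm w)) :=
  ⟨fun i => (hf.1 i).conj e, fun v _ _ h => hf.2 (e.symm v) (e.injective h)⟩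

/-! ### Arc-disjoint strong subgraphs and hamiltonian decompositions -/

namespace Digraph

/-- The image under `e` of the functional graph of `f`, as a subgraph of the complete digraph. -/
def cycleSubdigraph {V W : Type*} (e : W → V) (f : W → W) : (symmComplete V).Subdigraph where
  verts := Set.range e
  Adj x y := x ≠ y ∧ ∃ a, e a = x ∧ e (f a) = y
  adj_sub h := h.1
  tail_mem h := by obtain ⟨-, a, rfl, -⟩ := h; exact ⟨a, rfl⟩
  head_mem h := by obtain ⟨-, a, -, rfl⟩ := h; exact ⟨f a, rfl⟩

theorem cycleSubdigraph_strong {V W : Type*} [Nonempty W] (e : W → V) {f : W → W}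
    (hf : CyclicMap f) : (cycleSubdigraph e f).Strong := by
  refine ⟨Set.range_nonempty e, ?_⟩
  rintro _ ⟨a, rfl⟩ _ ⟨b, rfl⟩
  obtain ⟨k, rfl⟩ := hf a b
  induction k with
  | zero => exact .refl
  | succ k ih =>
    rw [Function.iterate_succ_apply']
    -- A step collapsed to a loop is not an arc; the walk stays in place there.
    by_cases h : e (f^[k] a) = e (f (f^[k] a))
    · rwa [← h]
    · exact ih.tail ⟨h, _, rfl, rfl⟩

theorem cycleSubdigraph_disjoint {V W : Type*} {e : W → V} (he : Function.Injective e)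
    {f g : W → W} (h : ∀ a, f a ≠ g a) :
    Disjoint (cycleSubdigraph e f).arcs (cycleSubdigraph e g).arcs := by
  rw [Set.disjoint_left]
  rintro ⟨x, y⟩ ⟨-, a, ha, ha'⟩ ⟨-, b, hb, hb'⟩
  obtain rfl := he (ha.trans hb.symm)
  exact h a (he (ha'.trans hb'.symm))

/-- All arcs between `v` and the other vertices. -/
def starSubdigraph {V : Type*} (v : V) : (symmComplete V).Subdigraph where
  verts := Set.univ
  Adj x y := x ≠ y ∧ (x = v ∨ y = v)
  adj_sub h := h.1
  tail_mem _ := Set.mem_univ _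
  head_mem _ := Set.mem_univ _

theorem starSubdigraph_strong {V : Type*} (v : V) : (starSubdigraph v).Strong := by
  refine ⟨⟨v, Set.mem_univ _⟩, fun a _ b _ => ?_⟩
  have h1 : Relation.ReflTransGen (starSubdigraph v).Adj a v := by
    by_cases h : a = v
    · rw [h]
    · exact .single ⟨h, Or.inr rfl⟩
  have h2 : Relation.ReflTransGen (starSubdigraph v).Adj v b := by
    by_cases h : v = b
    · rw [h]
    · exact .single ⟨h, Or.inl rfl⟩
  exact h1.trans h2

theorem hasArcDisjointStrong_of_fintype {V ι : Type*} [Fintype ι] {D : Digraph V} {S : Finset V}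
    (H : ι → D.Subdigraph) (h1 : ∀ i, (H i).Strong ∧ (S : Set V) ⊆ (H i).verts)
    (h2 : ∀ i j, i ≠ j → Disjoint (H i).arcs (H j).arcs) :
    D.HasArcDisjointStrong S (Fintype.card ι) := by
  let e := (Fintype.equivFin ι).symm
  exact ⟨fun i => H (e i), fun i => h1 _, fun i j hij => h2 _ _ (e.injective.ne hij)⟩

theorem hasArcDisjointStrong_of_factorization {V W ι : Type*} [Fintype ι] [Nonempty W]
    (e : W ≃ V) {f : ι → W → W} (hf : IsCyclicFactorization f) (S : Finset V) :
    (symmComplete V).HasArcDisjointStrong S (Fintype.card ι) := by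
  refine hasArcDisjointStrong_of_fintype (fun i => cycleSubdigraph e (f i))
    (fun i => ⟨cycleSubdigraph_strong e (hf.1 i), fun x _ => e.surjective x⟩)
    (fun i j hij => cycleSubdigraph_disjoint e.injective fun a h => hij (hf.2 a h))

/-- The cycles avoid `v` altogether, so the star formed by all arcs at `v` is disjoint from them and
is a further strong subgraph. -/
theorem hasArcDisjointStrong_succ_of_factorization {V W ι : Type*} [Fintype ι] [Nonempty W]
    {v : V} (e : W ≃ {x : V // x ≠ v}) {f : ι → W → W} (hf : IsCyclicFactorization f)
    {S : Finset V} (hS : v ∉ S) :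
    (symmComplete V).HasArcDisjointStrong S (Fintype.card ι + 1) := by
  have he : Function.Injective fun a => (e a : V) :=
    Subtype.val_injective.comp e.injective
  have hd : ∀ i, Disjoint (starSubdigraph v).arcs
      (cycleSubdigraph (fun a => (e a : V)) (f i)).arcs := by
    intro i
    rw [Set.disjoint_left]
    rintro ⟨x, y⟩ ⟨-, h⟩ ⟨-, a, rfl, rfl⟩
    rcases h with h | h
    · exact (e a).2 h
    · exact (e (f i a)).2 h
  rw [← Fintype.card_option]
  refine hasArcDisjointStrong_of_fintype
    (fun i : Option ι => i.elim (starSubdigraph v)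
      fun i => cycleSubdigraph (fun a => (e a : V)) (f i)) ?_ ?_
  · rintro (_ | i)
    · exact ⟨starSubdigraph_strong v, fun x _ => Set.mem_univ _⟩
    · refine ⟨cycleSubdigraph_strong _ (hf.1 i), fun x hx => ?_⟩
      have hxv : x ≠ v := fun h => hS (h ▸ hx)
      exact ⟨e.symm ⟨x, hxv⟩, by simp⟩
  · rintro (_ | i) (_ | j) hij
    · exact absurd rfl hij
    · exact hd j
    · exact (hd i).symm
    · exact cycleSubdigraph_disjoint he fun a h => hij (by rw [hf.2 a h])

theorem Subdigraph.Strong.exists_adj {V : Type*} {D : Digraph V} {H : D.Subdigraph}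
    (h : H.Strong) {s t : V} (hs : s ∈ H.verts) (ht : t ∈ H.verts) (hst : s ≠ t) :
    ∃ v, H.Adj s v := by
  rcases Relation.ReflTransGen.cases_head (h.2 s hs t ht) with h | ⟨c, hc, -⟩
  · exact absurd h hst
  · exact ⟨c, hc⟩

/-- Each subgraph has to leave a fixed `s ∈ S`, along an arc used by no other subgraph. -/
theorem HasArcDisjointStrong.le_card_sub_one {V : Type*} [Fintype V] {S : Finset V} {p : ℕ}
    (h : (symmComplete V).HasArcDisjointStrong S p) (hS : 1 < S.card) :
    p ≤ Fintype.card V - 1 := by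
  classical
  obtain ⟨H, h1, h2⟩ := h
  obtain ⟨s, hs, t, ht, hst⟩ := Finset.one_lt_card.1 hS
  choose f hf using fun i => (h1 i).1.exists_adj ((h1 i).2 hs) ((h1 i).2 ht) hst
  have hinj : Function.Injective fun i => (⟨f i, fun h => (H i).adj_sub (hf i) h.symm⟩ :
      {x // x ≠ s}) := by
    intro i j hij
    by_contra hne
    have hfe : f i = f j := congrArg Subtype.val hij
    exact Set.disjoint_left.1 (h2 i j hne) (show (s, f i) ∈ _ from hf i)
      (show (H j).Adj s (f i) from hfe ▸ hf j)
  simpa using Fintype.card_le_of_injective _ hinj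

/-- The out-degree count is tight: every vertex has exactly `p` out-arcs and each of the `p`
subgraphs uses at least one, hence exactly one. Each subgraph is thus the functional graph of a map,
which is cyclic by strong connectivity. -/
theorem HasArcDisjointStrong.exists_factorization {V : Type*} [Fintype V] [Nontrivial V] {p : ℕ}
    (h : (symmComplete V).HasArcDisjointStrong Finset.univ p) (hp : p + 1 = Fintype.card V) :
    ∃ f : Fin p → V → V, IsCyclicFactorization f := by
  classical
  obtain ⟨H, h1, h2⟩ := h
  have hv : ∀ i x, x ∈ (H i).verts := fun i x => (h1 i).2 (by simp)
  have hex : ∀ i x, ∃ y, (H i).Adj x y := by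
    intro i x
    obtain ⟨y, hy⟩ := exists_ne x
    exact (h1 i).1.exists_adj (hv i x) (hv i y) hy.symm
  choose f hf using hex
  have hd : ∀ i j x y, (H i).Adj x y → (H j).Adj x y → i = j := by
    intro i j x y hi hj
    by_contra hne
    exact Set.disjoint_left.1 (h2 i j hne) (show (x, y) ∈ _ from hi) (show (H j).Adj x y from hj)
  have hinj : ∀ x, Function.Injective fun i => f i x := by
    intro x i j hij
    exact hd i j x (f i x) (hf i x) (by have : f i x = f j x := hij; rw [this]; exact hf j x)
  have huniq : ∀ i x y, (H i).Adj x y → f i x = y := by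
    intro i x y hxy
    have hb : Function.Bijective fun i => (⟨f i x, fun h => (H i).adj_sub (hf i x) h.symm⟩ :
        {z // z ≠ x}) := by
      rw [Fintype.bijective_iff_injective_and_card]
      refine ⟨fun i j hij => hinj x (congrArg Subtype.val hij), ?_⟩
      simp [← hp]
    obtain ⟨j, hj⟩ := hb.2 ⟨y, fun h => (H i).adj_sub hxy h.symm⟩
    have hj' : f j x = y := congrArg Subtype.val hj
    rw [hd i j x y hxy (hj' ▸ hf j x), hj']
  refine ⟨f, fun i u v => ?_, hinj⟩
  induction (h1 i).1.2 u (hv i u) v (hv i v) with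
  | refl => exact ⟨0, rfl⟩
  | tail _ hbc ih =>
    obtain ⟨k, hk⟩ := ih
    exact ⟨k + 1, by rw [Function.iterate_succ_apply', hk, huniq i _ _ hbc]⟩

theorem localStrongArcConn_eq {V : Type*} {D : Digraph V} {S : Finset V} {p : ℕ}
    (h : D.HasArcDisjointStrong S p) (hle : ∀ q, D.HasArcDisjointStrong S q → q ≤ p) :
    D.localStrongArcConn S = p :=
  le_antisymm (iSup₂_le fun q hq => Nat.cast_le.2 (hle q hq))
    (le_iSup₂ (f := fun (q : ℕ) (_ : D.HasArcDisjointStrong S q) => (q : ℕ∞)) p h)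

theorem strongArcConn_eq {V : Type*} [Fintype V] {D : Digraph V} {k p : ℕ}
    (hk : k ≤ Fintype.card V)
    (h : ∀ S : Finset V, S.card = k → D.HasArcDisjointStrong S p)
    (hle : ∀ S : Finset V, S.card = k → ∀ q, D.HasArcDisjointStrong S q → q ≤ p) :
    D.strongArcConn k = p := by
  obtain ⟨S, -, hS⟩ := Finset.exists_subset_card_eq (s := Finset.univ) (n := k) (by simpa using hk)
  refine le_antisymm ((iInf₂_le S hS).trans (localStrongArcConn_eq (h S hS) (hle S hS)).le)
    (le_iInf₂ fun T hT => (localStrongArcConn_eq (h T hT) (hle T hT)).ge)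

end Digraph

/-! ### Perfect matchings on the residues and infinity, and maps following them -/

/-- The involution matching `x` with `s - x`, the fixed vertex of `x ↦ s - x` being matched
with the point at infinity. For odd `N` these are `N` edge-disjoint perfect matchings. -/
def pairing {N : ℕ} (s : ZMod N) : Option (ZMod N) → Option (ZMod N)
  | none => some (s * ((N + 1) / 2 : ℕ))
  | some x => if x + x = s then none else some (s - x)

theorem two_mul_half {M : ℕ} : (2 : ZMod (2 * M + 1)) * ((2 * M + 1 + 1) / 2 : ℕ) = 1 := by
  rw [show (2 * M + 1 + 1) / 2 = M + 1 by omega]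
  have : ((2 * M + 1 : ℕ) : ZMod (2 * M + 1)) = 0 := ZMod.natCast_self _
  push_cast at this ⊢
  linear_combination this

theorem pairing_none_eq {M : ℕ} {s x : ZMod (2 * M + 1)} (h : x + x = s) :
    pairing s none = some x := by
  have := two_mul_half (M := M)
  simp only [pairing, Option.some.injEq]
  linear_combination (-((2 * M + 1 + 1) / 2 : ℕ) : ZMod (2 * M + 1)) * h + x * this

/-- The number can be read off from a matched pair: it is `x + y` for two residues and `2 * x` for
`x` and infinity. This turns arc-disjointness into a comparison of numbers. -/
theorem pairing_injective {M : ℕ} (v : Option (ZMod (2 * M + 1))) :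
    Function.Injective fun s : ZMod (2 * M + 1) => pairing s v := by
  intro s t h
  have h2 := two_mul_half (M := M)
  rcases v with _ | x
  · simp only [pairing, Option.some.injEq] at h
    linear_combination 2 * h + (t - s) * h2
  · simp only [pairing] at h
    split_ifs at h with h3 h4
    · rw [← h3, ← h4]
    · simpa using h

/-- Translation by `r`, fixing the point at infinity. -/
def shiftFinite {N : ℕ} (r : ZMod N) : Option (ZMod N) ≃ Option (ZMod N) :=
  (Equiv.addRight r).optionCongr

theorem shiftFinite_none {N : ℕ} (r : ZMod N) : shiftFinite r none = none := rfl

theorem shiftFinite_some {N : ℕ} (r x : ZMod N) : shiftFinite r (some x) = some (x + r) := rfl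

theorem shiftFinite_symm_none {N : ℕ} (r : ZMod N) : (shiftFinite r).symm none = none := rfl

theorem shiftFinite_symm_some {N : ℕ} (r x : ZMod N) :
    (shiftFinite r).symm (some x) = some (x - r) := by
  rw [Equiv.symm_apply_eq, shiftFinite_some, sub_add_cancel]

/-- Pairs with sum `s` move to pairs with sum `s + 2r`, and the partner `s / 2` of infinity moves to
`s / 2 + r`. -/
theorem pairing_shiftFinite {M : ℕ} (s r : ZMod (2 * M + 1)) (v : Option (ZMod (2 * M + 1))) :
    pairing (s + (r + r)) (shiftFinite r v) = shiftFinite r (pairing s v) := by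
  have h2 := two_mul_half (M := M)
  rcases v with _ | x
  · simp only [pairing, shiftFinite_none, shiftFinite_some, Option.some.injEq]
    linear_combination r * h2
  · have h3 : x + r + (x + r) = s + (r + r) ↔ x + x = s :=
      ⟨fun h => by linear_combination h, fun h => by linear_combination h⟩
    simp only [pairing, shiftFinite_some, h3]
    split_ifs
    · rfl
    · rw [shiftFinite_some]
      congr 1
      ring

/-- The map which at the integer `a`, `|a| ≤ M`, follows the matching number `g a`, and at
infinity the matching number `g₀`. -/
def follow (M : ℕ) (g₀ : ℤ) (g : ℤ → ℤ) (v : Option (ZMod (2 * M + 1))) :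
    Option (ZMod (2 * M + 1)) :=
  pairing ((v.elim g₀ fun x => g x.valMinAbs : ℤ) : ZMod (2 * M + 1)) v

theorem valMinAbs_intCast_of_abs_le {M : ℕ} {a : ℤ} (h1 : -M ≤ a) (h2 : a ≤ M) :
    (a : ZMod (2 * M + 1)).valMinAbs = a := by
  rw [ZMod.valMinAbs_spec]
  refine ⟨rfl, ?_, ?_⟩ <;> push_cast <;> omega

theorem abs_valMinAbs_le {M : ℕ} (x : ZMod (2 * M + 1)) :
    -(M : ℤ) ≤ x.valMinAbs ∧ x.valMinAbs ≤ M := by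
  have := ZMod.valMinAbs_mem_Ioc x
  rw [Set.mem_Ioc] at this
  push_cast at this
  omega

theorem intCast_eq_intCast_of {M : ℕ} {a b : ℤ}
    (h : a = b ∨ a = b + (2 * M + 1) ∨ a = b - (2 * M + 1)) :
    (a : ZMod (2 * M + 1)) = b := by
  have : ((2 * M + 1 : ℕ) : ZMod (2 * M + 1)) = 0 := ZMod.natCast_self _
  push_cast at this
  rcases h with rfl | rfl | rfl
  · rfl
  · push_cast; rw [this, add_zero]
  · push_cast; rw [this, sub_zero]

/-- To see that `follow M g₀ g` is cyclic it is enough to trace its orbit on integers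
representing the residues. -/
theorem cyclicMap_follow {M : ℕ} {g₀ : ℤ} {g : ℤ → ℤ}
    (hreach : ∀ P : ℤ → Prop,
      (∀ b : ℤ, -M ≤ b ∧ b ≤ M ∧
        (2 * b = g₀ ∨ 2 * b = g₀ + (2 * M + 1) ∨ 2 * b = g₀ - (2 * M + 1)) → P b) →
      (∀ s a b : ℤ, P a → g a = s → -M ≤ a ∧ a ≤ M ∧ -M ≤ b ∧ b ≤ M ∧ a ≠ b ∧
        (a + b = s ∨ a + b = s + (2 * M + 1) ∨ a + b = s - (2 * M + 1)) → P b) →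
      ∀ b : ℤ, -M ≤ b → b ≤ M → P b)
    (hlast : ∃ s b : ℤ, g b = s ∧ -M ≤ b ∧ b ≤ M ∧
      (2 * b = s ∨ 2 * b = s + (2 * M + 1) ∨ 2 * b = s - (2 * M + 1))) :
    CyclicMap (follow M g₀ g) := by
  -- The predicate fed to `hreach` is membership in the orbit of infinity.
  have key := hreach (fun b => ∃ k : ℕ, (follow M g₀ g)^[k] none = some (b : ZMod (2 * M + 1)))
    (fun b ⟨_, _, hb⟩ => ⟨1, by
      have h := intCast_eq_intCast_of hb
      push_cast at h
      simp only [Function.iterate_one, follow, Option.elim]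
      exact pairing_none_eq (by rw [← h]; ring)⟩)
    (fun s a b ⟨k, hk⟩ hg ⟨ha1, ha2, hb1, hb2, hab, h⟩ => ⟨k + 1, by
      have h := intCast_eq_intCast_of h
      have hne : (a : ZMod (2 * M + 1)) ≠ b := by
        intro he
        apply hab
        rw [← valMinAbs_intCast_of_abs_le ha1 ha2, he, valMinAbs_intCast_of_abs_le hb1 hb2]
      rw [Function.iterate_succ_apply', hk]
      simp only [follow, Option.elim, valMinAbs_intCast_of_abs_le ha1 ha2, pairing, hg, ← h]
      push_cast
      rw [if_neg (by simpa using hne)]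
      simp⟩)
  refine CyclicMap.of_forall_reach none ?_ ?_
  · rintro (_ | x)
    · exact ⟨0, rfl⟩
    · obtain ⟨h1, h2⟩ := abs_valMinAbs_le x
      simpa using key _ h1 h2
  · obtain ⟨s, b, hg, h1, h2, h⟩ := hlast
    refine ⟨some (b : ZMod (2 * M + 1)), ?_⟩
    have h := intCast_eq_intCast_of h
    simp only [follow, Option.elim, valMinAbs_intCast_of_abs_le h1 h2, pairing, hg, ← h]
    rw [if_pos (by push_cast; ring)]

/-- The orbits traced below run through blocks whose net effect is to change `k` by `2`, so the
induction stays in one parity class. -/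
theorem int_step_up {P : ℤ → Prop} {lo hi : ℤ} (h0 : P lo)
    (h : ∀ k, P k → k % 2 = lo % 2 → lo ≤ k → k + 2 ≤ hi → P (k + 2)) (k : ℤ)
    (hk : k % 2 = lo % 2) (hlo : lo ≤ k) (hhi : k ≤ hi) : P k := by
  obtain ⟨t, rfl⟩ : ∃ t : ℕ, k = lo + 2 * t := ⟨((k - lo) / 2).toNat, by omega⟩
  induction t with
  | zero => simpa using h0
  | succ t ih =>
    have := h _ (ih (by omega) (by omega) (by push_cast at hhi; omega)) (by omega) (by omega)
      (by push_cast at hhi; omega)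
    convert this using 1
    push_cast
    ring

theorem int_step_down {P : ℤ → Prop} {lo hi : ℤ} (h0 : P hi)
    (h : ∀ k, P k → k % 2 = hi % 2 → lo ≤ k - 2 → k ≤ hi → P (k - 2)) (k : ℤ)
    (hk : k % 2 = hi % 2) (hlo : lo ≤ k) (hhi : k ≤ hi) : P k := by
  have := int_step_up (P := fun k => P (-k)) (lo := -hi) (hi := -lo) (by simpa using h0)
    (fun k hk h1 h2 h3 => by
      have := h (-k) hk (by omega) (by omega) (by omega)
      convert this using 1
      ring) (-k) (by omega) (by omega) (by omega)
  simpa using this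

/-! ### Tables for the five central cycles -/

/-- Matching numbers followed by five cycles at the integer `a`, away from the ends. -/
def innerTable (a : ℤ) : Fin 5 → ℤ :=
  if a = 0 then ![1, -1, 2, -2, 0]
  else if 0 < a then if a % 2 = 1 then ![-2, 1, -1, 2, 0] else ![2, -1, 1, -2, 0]
  else if a % 2 = 1 then ![1, -2, 0, -1, 2] else ![1, 0, 2, -1, -2]

/-- The matching numbers followed at `|a| ≤ M` when `M` is odd. -/
def oddTable (M a : ℤ) : Fin 5 → ℤ :=
  if a = M - 1 then ![2, -1, -2, 1, 0]
  else if a = M then ![-1, 1, 2, -2, 0]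
  else if a = -M then ![2, -2, 1, 0, -1]
  else innerTable a

/-- The matching numbers followed at `|a| ≤ M` when `M` is even. -/
def evenTable (M a : ℤ) : Fin 5 → ℤ :=
  if a = M - 2 then ![2, -1, -2, 1, 0]
  else if a = M - 1 then ![-1, 1, 2, 0, -2]
  else if a = M then ![2, 0, -1, -2, 1]
  else if a = -M then ![1, -1, 2, 0, -2]
  else innerTable a

/-- In column `0` the exceptional row `M - 1` agrees with the interior rows of its parity, so the
first cycle need not treat it separately. -/
theorem oddTable_pos_even_zero {M a : ℤ} (h : 3 ≤ M ∧ 0 < a ∧ a < M ∧ a % 2 = 0) :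
    oddTable M a 0 = 2 := by
  unfold oddTable innerTable
  split_ifs <;> first | rfl | omega

theorem oddTable_top {M a : ℤ} (h : 3 ≤ M ∧ a = M) :
    oddTable M a = ![-1, 1, 2, -2, 0] := by
  unfold oddTable innerTable
  split_ifs <;> first | rfl | omega

theorem oddTable_top_sub_one {M a : ℤ} (h : 3 ≤ M ∧ a = M - 1) :
    oddTable M a = ![2, -1, -2, 1, 0] := by
  unfold oddTable innerTable
  split_ifs <;> first | rfl | omega

theorem oddTable_neg_top {M a : ℤ} (h : 3 ≤ M ∧ a = -M) :
    oddTable M a = ![2, -2, 1, 0, -1] := by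
  unfold oddTable innerTable
  split_ifs <;> first | rfl | omega

theorem oddTable_zero {M a : ℤ} (h : 3 ≤ M ∧ a = 0) :
    oddTable M a = ![1, -1, 2, -2, 0] := by
  unfold oddTable innerTable
  split_ifs <;> first | rfl | omega

theorem oddTable_pos_odd {M a : ℤ} (h : 3 ≤ M ∧ 0 < a ∧ a < M - 1 ∧ a % 2 = 1) :
    oddTable M a = ![-2, 1, -1, 2, 0] := by
  unfold oddTable innerTable
  split_ifs <;> first | rfl | omega

theorem oddTable_pos_even {M a : ℤ} (h : 3 ≤ M ∧ 0 < a ∧ a < M - 1 ∧ a % 2 = 0) :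
    oddTable M a = ![2, -1, 1, -2, 0] := by
  unfold oddTable innerTable
  split_ifs <;> first | rfl | omega

theorem oddTable_neg_odd {M a : ℤ} (h : 3 ≤ M ∧ a < 0 ∧ -M < a ∧ a % 2 = 1) :
    oddTable M a = ![1, -2, 0, -1, 2] := by
  unfold oddTable innerTable
  split_ifs <;> first | rfl | omega

theorem oddTable_neg_even {M a : ℤ} (h : 3 ≤ M ∧ a < 0 ∧ -M < a ∧ a % 2 = 0) :
    oddTable M a = ![1, 0, 2, -1, -2] := by
  unfold oddTable innerTable
  split_ifs <;> first | rfl | omega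

theorem evenTable_pos_even_zero {M a : ℤ} (h : 3 ≤ M ∧ 0 < a ∧ a < M - 1 ∧ a % 2 = 0) :
    evenTable M a 0 = 2 := by
  unfold evenTable innerTable
  split_ifs <;> first | rfl | omega

theorem evenTable_top {M a : ℤ} (h : 3 ≤ M ∧ a = M) :
    evenTable M a = ![2, 0, -1, -2, 1] := by
  unfold evenTable innerTable
  split_ifs <;> first | rfl | omega

theorem evenTable_top_sub_one {M a : ℤ} (h : 3 ≤ M ∧ a = M - 1) :
    evenTable M a = ![-1, 1, 2, 0, -2] := by
  unfold evenTable innerTable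
  split_ifs <;> first | rfl | omega

theorem evenTable_top_sub_two {M a : ℤ} (h : 3 ≤ M ∧ a = M - 2) :
    evenTable M a = ![2, -1, -2, 1, 0] := by
  unfold evenTable innerTable
  split_ifs <;> first | rfl | omega

theorem evenTable_neg_top {M a : ℤ} (h : 3 ≤ M ∧ a = -M) :
    evenTable M a = ![1, -1, 2, 0, -2] := by
  unfold evenTable innerTable
  split_ifs <;> first | rfl | omega

theorem evenTable_zero {M a : ℤ} (h : 3 ≤ M ∧ a = 0) :
    evenTable M a = ![1, -1, 2, -2, 0] := by
  unfold evenTable innerTable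
  split_ifs <;> first | rfl | omega

theorem evenTable_pos_odd {M a : ℤ} (h : 3 ≤ M ∧ 0 < a ∧ a < M - 2 ∧ a % 2 = 1) :
    evenTable M a = ![-2, 1, -1, 2, 0] := by
  unfold evenTable innerTable
  split_ifs <;> first | rfl | omega

theorem evenTable_pos_even {M a : ℤ} (h : 3 ≤ M ∧ 0 < a ∧ a < M - 2 ∧ a % 2 = 0) :
    evenTable M a = ![2, -1, 1, -2, 0] := by
  unfold evenTable innerTable
  split_ifs <;> first | rfl | omega

theorem evenTable_neg_odd {M a : ℤ} (h : 3 ≤ M ∧ a < 0 ∧ -M < a ∧ a % 2 = 1) :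
    evenTable M a = ![1, -2, 0, -1, 2] := by
  unfold evenTable innerTable
  split_ifs <;> first | rfl | omega

theorem evenTable_neg_even {M a : ℤ} (h : 3 ≤ M ∧ a < 0 ∧ -M < a ∧ a % 2 = 0) :
    evenTable M a = ![1, 0, 2, -1, -2] := by
  unfold evenTable innerTable
  split_ifs <;> first | rfl | omega

/-! ### Orbits of the central cycles, `M` odd -/

/-- The orbit is `∞, -1, 2, 0, 1`, then blocks `k, -(k + 2), k + 3, -(k + 1), k + 2` for odd `k` up
to `M - 4`, then `M - 2, -M, -(M - 1), M, ∞`. The other nine orbits are likewise made of two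
irregular ends joined by such blocks. -/
theorem cyclicMap_oddTable_zero {M : ℕ} (hM : 3 ≤ M) (hpar : M % 2 = 1) :
    CyclicMap (follow M (-2) fun a => oddTable M a 0) := by
  refine cyclicMap_follow (fun P h0 hs => ?_)
    ⟨-1, M, congrFun (oddTable_top (by omega)) 0, by omega⟩
  have p1 : P (-1) := h0 _ (by omega)
  have p2 : P 2 :=
    hs 1 _ _ p1 (congrFun (oddTable_neg_odd (by omega)) 0) (by omega)
  have p3 : P 0 :=
    hs 2 _ _ p2 (oddTable_pos_even_zero (by omega)) (by omega)
  have p4 : P 1 :=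
    hs 1 _ _ p3 (congrFun (oddTable_zero (by omega)) 0) (by omega)
  have a1 : ∀ k : ℤ, P k → k % 2 = 1 → 1 ≤ k → k ≤ M - 4 → P (-(k + 2)) :=
    fun k hk _ _ _ => hs (-2) _ _ hk
      (congrFun (oddTable_pos_odd (by omega)) 0) (by omega)
  have a2 : ∀ k : ℤ, P k → k % 2 = 1 → 1 ≤ k → k ≤ M - 4 → P (k + 3) :=
    fun k hk _ _ _ => hs 1 _ _ (a1 k hk (by omega) (by omega) (by omega))
      (congrFun (oddTable_neg_odd (by omega)) 0) (by omega)
  have a3 : ∀ k : ℤ, P k → k % 2 = 1 → 1 ≤ k → k ≤ M - 4 → P (-(k + 1)) :=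
    fun k hk _ _ _ => hs 2 _ _ (a2 k hk (by omega) (by omega) (by omega))
      (oddTable_pos_even_zero (by omega)) (by omega)
  have a4 : ∀ k : ℤ, P k → k % 2 = 1 → 1 ≤ k → k ≤ M - 4 → P (k + 2) :=
    fun k hk _ _ _ => hs 1 _ _ (a3 k hk (by omega) (by omega) (by omega))
      (congrFun (oddTable_neg_even (by omega)) 0) (by omega)
  have a : ∀ k : ℤ, k % 2 = 1 → 1 ≤ k → k ≤ M - 2 → P k := fun k _ _ _ =>
    int_step_up (lo := 1) (hi := M - 2) p4
      (fun k hk _ _ _ => a4 k hk (by omega) (by omega) (by omega)) k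
      (by omega) (by omega) (by omega)
  have p5 : P (M - 2) := a _ (by omega) (by omega) (by omega)
  have p6 : P (-M) :=
    hs (-2) _ _ p5 (congrFun (oddTable_pos_odd (by omega)) 0) (by omega)
  have p7 : P (-(M - 1)) :=
    hs 2 _ _ p6 (congrFun (oddTable_neg_top (by omega)) 0) (by omega)
  have p8 : P M :=
    hs 1 _ _ p7 (congrFun (oddTable_neg_even (by omega)) 0) (by omega)
  intro b hb1 hb2
  -- A missed `b` would differ from the isolated points (`n1` to `n8`) and from all block entries
  -- (`l1` to `l4`); sign, parity and size leave no such integer.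
  by_contra hb
  have n1 : b ≠ -1 := fun h => hb (h ▸ p1)
  have n2 : b ≠ 2 := fun h => hb (h ▸ p2)
  have n3 : b ≠ 0 := fun h => hb (h ▸ p3)
  have n4 : b ≠ 1 := fun h => hb (h ▸ p4)
  have n5 : b ≠ M - 2 := fun h => hb (h ▸ p5)
  have n6 : b ≠ -M := fun h => hb (h ▸ p6)
  have n7 : b ≠ -(M - 1) := fun h => hb (h ▸ p7)
  have n8 : b ≠ M := fun h => hb (h ▸ p8)
  have l1 : ¬((-b - 2) % 2 = 1 ∧ 1 ≤ -b - 2 ∧ -b - 2 ≤ M - 4) := fun ⟨h1, h2, h3⟩ =>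
    hb ((show -((-b - 2) + 2) = b by ring) ▸ a1 (-b - 2) (a _ h1 (by omega) (by omega)) h1 h2 h3)
  have l2 : ¬((b - 3) % 2 = 1 ∧ 1 ≤ b - 3 ∧ b - 3 ≤ M - 4) := fun ⟨h1, h2, h3⟩ =>
    hb ((show (b - 3) + 3 = b by ring) ▸ a2 (b - 3) (a _ h1 (by omega) (by omega)) h1 h2 h3)
  have l3 : ¬((-b - 1) % 2 = 1 ∧ 1 ≤ -b - 1 ∧ -b - 1 ≤ M - 4) := fun ⟨h1, h2, h3⟩ =>
    hb ((show -((-b - 1) + 1) = b by ring) ▸ a3 (-b - 1) (a _ h1 (by omega) (by omega)) h1 h2 h3)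
  have l4 : ¬((b - 2) % 2 = 1 ∧ 1 ≤ b - 2 ∧ b - 2 ≤ M - 4) := fun ⟨h1, h2, h3⟩ =>
    hb ((show (b - 2) + 2 = b by ring) ▸ a4 (b - 2) (a _ h1 (by omega) (by omega)) h1 h2 h3)
  omega

/-- Here the blocks descend: `k, -(k - 1), k - 1, -k, k - 2`, from `M - 2` to `1`. -/
theorem cyclicMap_oddTable_one {M : ℕ} (hM : 3 ≤ M) (hpar : M % 2 = 1) :
    CyclicMap (follow M (-1) fun a => oddTable M a 1) := by
  refine cyclicMap_follow (fun P h0 hs => ?_)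
    ⟨-2, -1, congrFun (oddTable_neg_odd (by omega)) 1, by omega⟩
  have p1 : P M := h0 _ (by omega)
  have p2 : P (-(M - 1)) :=
    hs 1 _ _ p1 (congrFun (oddTable_top (by omega)) 1) (by omega)
  have p3 : P (M - 1) :=
    hs 0 _ _ p2 (congrFun (oddTable_neg_even (by omega)) 1) (by omega)
  have p4 : P (-M) :=
    hs (-1) _ _ p3 (congrFun (oddTable_top_sub_one (by omega)) 1) (by omega)
  have p5 : P (M - 2) :=
    hs (-2) _ _ p4 (congrFun (oddTable_neg_top (by omega)) 1) (by omega)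
  have a1 : ∀ k : ℤ, P k → k % 2 = 1 → 3 ≤ k → k ≤ M - 2 → P (-(k - 1)) :=
    fun k hk _ _ _ => hs 1 _ _ hk
      (congrFun (oddTable_pos_odd (by omega)) 1) (by omega)
  have a2 : ∀ k : ℤ, P k → k % 2 = 1 → 3 ≤ k → k ≤ M - 2 → P (k - 1) :=
    fun k hk _ _ _ => hs 0 _ _ (a1 k hk (by omega) (by omega) (by omega))
      (congrFun (oddTable_neg_even (by omega)) 1) (by omega)
  have a3 : ∀ k : ℤ, P k → k % 2 = 1 → 3 ≤ k → k ≤ M - 2 → P (-k) :=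
    fun k hk _ _ _ => hs (-1) _ _ (a2 k hk (by omega) (by omega) (by omega))
      (congrFun (oddTable_pos_even (by omega)) 1) (by omega)
  have a4 : ∀ k : ℤ, P k → k % 2 = 1 → 3 ≤ k → k ≤ M - 2 → P (k - 2) :=
    fun k hk _ _ _ => hs (-2) _ _ (a3 k hk (by omega) (by omega) (by omega))
      (congrFun (oddTable_neg_odd (by omega)) 1) (by omega)
  have a : ∀ k : ℤ, k % 2 = 1 → 1 ≤ k → k ≤ M - 2 → P k := fun k _ _ _ =>
    int_step_down (lo := 1) (hi := M - 2) p5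
      (fun k hk _ _ _ => a4 k hk (by omega) (by omega) (by omega)) k
      (by omega) (by omega) (by omega)
  have p6 : P 1 := a _ (by omega) (by omega) (by omega)
  have p7 : P 0 :=
    hs 1 _ _ p6 (congrFun (oddTable_pos_odd (by omega)) 1) (by omega)
  have p8 : P (-1) :=
    hs (-1) _ _ p7 (congrFun (oddTable_zero (by omega)) 1) (by omega)
  intro b hb1 hb2
  by_contra hb
  have n1 : b ≠ M := fun h => hb (h ▸ p1)
  have n2 : b ≠ -(M - 1) := fun h => hb (h ▸ p2)
  have n3 : b ≠ M - 1 := fun h => hb (h ▸ p3)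
  have n4 : b ≠ -M := fun h => hb (h ▸ p4)
  have n5 : b ≠ M - 2 := fun h => hb (h ▸ p5)
  have n6 : b ≠ 1 := fun h => hb (h ▸ p6)
  have n7 : b ≠ 0 := fun h => hb (h ▸ p7)
  have n8 : b ≠ -1 := fun h => hb (h ▸ p8)
  have l1 : ¬((-b + 1) % 2 = 1 ∧ 3 ≤ -b + 1 ∧ -b + 1 ≤ M - 2) := fun ⟨h1, h2, h3⟩ =>
    hb ((show -((-b + 1) - 1) = b by ring) ▸ a1 (-b + 1) (a _ h1 (by omega) (by omega)) h1 h2 h3)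
  have l2 : ¬((b + 1) % 2 = 1 ∧ 3 ≤ b + 1 ∧ b + 1 ≤ M - 2) := fun ⟨h1, h2, h3⟩ =>
    hb ((show (b + 1) - 1 = b by ring) ▸ a2 (b + 1) (a _ h1 (by omega) (by omega)) h1 h2 h3)
  have l3 : ¬((-b) % 2 = 1 ∧ 3 ≤ -b ∧ -b ≤ M - 2) := fun ⟨h1, h2, h3⟩ =>
    hb ((show -(-b) = b by ring) ▸ a3 (-b) (a _ h1 (by omega) (by omega)) h1 h2 h3)
  have l4 : ¬((b + 2) % 2 = 1 ∧ 3 ≤ b + 2 ∧ b + 2 ≤ M - 2) := fun ⟨h1, h2, h3⟩ =>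
    hb ((show (b + 2) - 2 = b by ring) ▸ a4 (b + 2) (a _ h1 (by omega) (by omega)) h1 h2 h3)
  omega

theorem cyclicMap_oddTable_two {M : ℕ} (hM : 3 ≤ M) (hpar : M % 2 = 1) :
    CyclicMap (follow M 0 fun a => oddTable M a 2) := by
  refine cyclicMap_follow (fun P h0 hs => ?_)
    ⟨1, -M, congrFun (oddTable_neg_top (by omega)) 2, by omega⟩
  have p1 : P 0 := h0 _ (by omega)
  have p2 : P 2 :=
    hs 2 _ _ p1 (congrFun (oddTable_zero (by omega)) 2) (by omega)
  have a1 : ∀ k : ℤ, P k → k % 2 = 0 → 2 ≤ k → k ≤ M - 3 → P (-(k - 1)) :=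
    fun k hk _ _ _ => hs 1 _ _ hk
      (congrFun (oddTable_pos_even (by omega)) 2) (by omega)
  have a2 : ∀ k : ℤ, P k → k % 2 = 0 → 2 ≤ k → k ≤ M - 3 → P (k - 1) :=
    fun k hk _ _ _ => hs 0 _ _ (a1 k hk (by omega) (by omega) (by omega))
      (congrFun (oddTable_neg_odd (by omega)) 2) (by omega)
  have a3 : ∀ k : ℤ, P k → k % 2 = 0 → 2 ≤ k → k ≤ M - 3 → P (-k) :=
    fun k hk _ _ _ => hs (-1) _ _ (a2 k hk (by omega) (by omega) (by omega))
      (congrFun (oddTable_pos_odd (by omega)) 2) (by omega)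
  have a4 : ∀ k : ℤ, P k → k % 2 = 0 → 2 ≤ k → k ≤ M - 3 → P (k + 2) :=
    fun k hk _ _ _ => hs 2 _ _ (a3 k hk (by omega) (by omega) (by omega))
      (congrFun (oddTable_neg_even (by omega)) 2) (by omega)
  have a : ∀ k : ℤ, k % 2 = 0 → 2 ≤ k → k ≤ M - 1 → P k := fun k _ _ _ =>
    int_step_up (lo := 2) (hi := M - 1) p2
      (fun k hk _ _ _ => a4 k hk (by omega) (by omega) (by omega)) k
      (by omega) (by omega) (by omega)
  have p3 : P (M - 1) := a _ (by omega) (by omega) (by omega)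
  have p4 : P M :=
    hs (-2) _ _ p3 (congrFun (oddTable_top_sub_one (by omega)) 2) (by omega)
  have p5 : P (-(M - 2)) :=
    hs 2 _ _ p4 (congrFun (oddTable_top (by omega)) 2) (by omega)
  have p6 : P (M - 2) :=
    hs 0 _ _ p5 (congrFun (oddTable_neg_odd (by omega)) 2) (by omega)
  have p7 : P (-(M - 1)) :=
    hs (-1) _ _ p6 (congrFun (oddTable_pos_odd (by omega)) 2) (by omega)
  have p8 : P (-M) :=
    hs 2 _ _ p7 (congrFun (oddTable_neg_even (by omega)) 2) (by omega)
  intro b hb1 hb2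
  by_contra hb
  have n1 : b ≠ 0 := fun h => hb (h ▸ p1)
  have n2 : b ≠ 2 := fun h => hb (h ▸ p2)
  have n3 : b ≠ M - 1 := fun h => hb (h ▸ p3)
  have n4 : b ≠ M := fun h => hb (h ▸ p4)
  have n5 : b ≠ -(M - 2) := fun h => hb (h ▸ p5)
  have n6 : b ≠ M - 2 := fun h => hb (h ▸ p6)
  have n7 : b ≠ -(M - 1) := fun h => hb (h ▸ p7)
  have n8 : b ≠ -M := fun h => hb (h ▸ p8)
  have l1 : ¬((-b + 1) % 2 = 0 ∧ 2 ≤ -b + 1 ∧ -b + 1 ≤ M - 3) := fun ⟨h1, h2, h3⟩ =>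
    hb ((show -((-b + 1) - 1) = b by ring) ▸ a1 (-b + 1) (a _ h1 (by omega) (by omega)) h1 h2 h3)
  have l2 : ¬((b + 1) % 2 = 0 ∧ 2 ≤ b + 1 ∧ b + 1 ≤ M - 3) := fun ⟨h1, h2, h3⟩ =>
    hb ((show (b + 1) - 1 = b by ring) ▸ a2 (b + 1) (a _ h1 (by omega) (by omega)) h1 h2 h3)
  have l3 : ¬((-b) % 2 = 0 ∧ 2 ≤ -b ∧ -b ≤ M - 3) := fun ⟨h1, h2, h3⟩ =>
    hb ((show -(-b) = b by ring) ▸ a3 (-b) (a _ h1 (by omega) (by omega)) h1 h2 h3)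
  have l4 : ¬((b - 2) % 2 = 0 ∧ 2 ≤ b - 2 ∧ b - 2 ≤ M - 3) := fun ⟨h1, h2, h3⟩ =>
    hb ((show (b - 2) + 2 = b by ring) ▸ a4 (b - 2) (a _ h1 (by omega) (by omega)) h1 h2 h3)
  omega

/-- The blocks start at negative integers, `-k, k - 1, -(k + 1), k, -(k - 2)`, so the induction
concerns `P (-k)`. -/
theorem cyclicMap_oddTable_three {M : ℕ} (hM : 3 ≤ M) (hpar : M % 2 = 1) :
    CyclicMap (follow M 1 fun a => oddTable M a 3) := by
  refine cyclicMap_follow (fun P h0 hs => ?_)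
    ⟨2, 1, congrFun (oddTable_pos_odd (by omega)) 3, by omega⟩
  have p1 : P (-M) := h0 _ (by omega)
  have p2 : P M :=
    hs 0 _ _ p1 (congrFun (oddTable_neg_top (by omega)) 3) (by omega)
  have p3 : P (M - 1) :=
    hs (-2) _ _ p2 (congrFun (oddTable_top (by omega)) 3) (by omega)
  have p4 : P (-(M - 2)) :=
    hs 1 _ _ p3 (congrFun (oddTable_top_sub_one (by omega)) 3) (by omega)
  have a1 : ∀ k : ℤ, P (-k) → k % 2 = 1 → 3 ≤ k → k ≤ M - 2 → P (k - 1) :=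
    fun k hk _ _ _ => hs (-1) _ _ hk
      (congrFun (oddTable_neg_odd (by omega)) 3) (by omega)
  have a2 : ∀ k : ℤ, P (-k) → k % 2 = 1 → 3 ≤ k → k ≤ M - 2 → P (-(k + 1)) :=
    fun k hk _ _ _ => hs (-2) _ _ (a1 k hk (by omega) (by omega) (by omega))
      (congrFun (oddTable_pos_even (by omega)) 3) (by omega)
  have a3 : ∀ k : ℤ, P (-k) → k % 2 = 1 → 3 ≤ k → k ≤ M - 2 → P k :=
    fun k hk _ _ _ => hs (-1) _ _ (a2 k hk (by omega) (by omega) (by omega))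
      (congrFun (oddTable_neg_even (by omega)) 3) (by omega)
  have a4 : ∀ k : ℤ, P (-k) → k % 2 = 1 → 3 ≤ k → k ≤ M - 2 → P (-(k - 2)) :=
    fun k hk _ _ _ => hs 2 _ _ (a3 k hk (by omega) (by omega) (by omega))
      (congrFun (oddTable_pos_odd (by omega)) 3) (by omega)
  have a : ∀ k : ℤ, k % 2 = 1 → 1 ≤ k → k ≤ M - 2 → P (-k) := fun k _ _ _ =>
    int_step_down (P := fun k => P (-k)) (lo := 1) (hi := M - 2) p4
      (fun k hk _ _ _ => a4 k hk (by omega) (by omega) (by omega)) k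
      (by omega) (by omega) (by omega)
  have p5 : P (-1) := a 1 (by omega) (by omega) (by omega)
  have p6 : P 0 :=
    hs (-1) _ _ p5 (congrFun (oddTable_neg_odd (by omega)) 3) (by omega)
  have p7 : P (-2) :=
    hs (-2) _ _ p6 (congrFun (oddTable_zero (by omega)) 3) (by omega)
  have p8 : P 1 :=
    hs (-1) _ _ p7 (congrFun (oddTable_neg_even (by omega)) 3) (by omega)
  intro b hb1 hb2
  by_contra hb
  have n1 : b ≠ -M := fun h => hb (h ▸ p1)
  have n2 : b ≠ M := fun h => hb (h ▸ p2)
  have n3 : b ≠ M - 1 := fun h => hb (h ▸ p3)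
  have n4 : b ≠ -(M - 2) := fun h => hb (h ▸ p4)
  have n5 : b ≠ -1 := fun h => hb (h ▸ p5)
  have n6 : b ≠ 0 := fun h => hb (h ▸ p6)
  have n7 : b ≠ -2 := fun h => hb (h ▸ p7)
  have n8 : b ≠ 1 := fun h => hb (h ▸ p8)
  have l1 : ¬((b + 1) % 2 = 1 ∧ 3 ≤ b + 1 ∧ b + 1 ≤ M - 2) := fun ⟨h1, h2, h3⟩ =>
    hb ((show (b + 1) - 1 = b by ring) ▸ a1 (b + 1) (a _ h1 (by omega) (by omega)) h1 h2 h3)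
  have l2 : ¬((-b - 1) % 2 = 1 ∧ 3 ≤ -b - 1 ∧ -b - 1 ≤ M - 2) := fun ⟨h1, h2, h3⟩ =>
    hb ((show -((-b - 1) + 1) = b by ring) ▸ a2 (-b - 1) (a _ h1 (by omega) (by omega)) h1 h2 h3)
  have l3 : ¬((b) % 2 = 1 ∧ 3 ≤ b ∧ b ≤ M - 2) := fun ⟨h1, h2, h3⟩ =>
    hb ((show (b) = b by ring) ▸ a3 (b) (a _ h1 (by omega) (by omega)) h1 h2 h3)
  have l4 : ¬((-b + 2) % 2 = 1 ∧ 3 ≤ -b + 2 ∧ -b + 2 ≤ M - 2) := fun ⟨h1, h2, h3⟩ =>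
    hb ((show -((-b + 2) - 2) = b by ring) ▸ a4 (-b + 2) (a _ h1 (by omega) (by omega)) h1 h2 h3)
  omega

/-- Two runs are needed: `k, -k, k + 2` climbs through the odd `k`, the orbit turns at `M, -M, M -
1`, and `k, -k, k - 2` descends through the even `k` to `0`. -/
theorem cyclicMap_oddTable_four {M : ℕ} (hM : 3 ≤ M) (hpar : M % 2 = 1) :
    CyclicMap (follow M 2 fun a => oddTable M a 4) := by
  refine cyclicMap_follow (fun P h0 hs => ?_)
    ⟨0, 0, congrFun (oddTable_zero (by omega)) 4, by omega⟩
  have p1 : P 1 := h0 _ (by omega)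
  have a1 : ∀ k : ℤ, P k → k % 2 = 1 → 1 ≤ k → k ≤ M - 2 → P (-k) :=
    fun k hk _ _ _ => hs 0 _ _ hk
      (congrFun (oddTable_pos_odd (by omega)) 4) (by omega)
  have a2 : ∀ k : ℤ, P k → k % 2 = 1 → 1 ≤ k → k ≤ M - 2 → P (k + 2) :=
    fun k hk _ _ _ => hs 2 _ _ (a1 k hk (by omega) (by omega) (by omega))
      (congrFun (oddTable_neg_odd (by omega)) 4) (by omega)
  have a : ∀ k : ℤ, k % 2 = 1 → 1 ≤ k → k ≤ M → P k := fun k _ _ _ =>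
    int_step_up (lo := 1) (hi := M) p1
      (fun k hk _ _ _ => a2 k hk (by omega) (by omega) (by omega)) k
      (by omega) (by omega) (by omega)
  have p2 : P M := a _ (by omega) (by omega) (by omega)
  have p3 : P (-M) :=
    hs 0 _ _ p2 (congrFun (oddTable_top (by omega)) 4) (by omega)
  have p4 : P (M - 1) :=
    hs (-1) _ _ p3 (congrFun (oddTable_neg_top (by omega)) 4) (by omega)
  have p5 : P (-(M - 1)) :=
    hs 0 _ _ p4 (congrFun (oddTable_top_sub_one (by omega)) 4) (by omega)
  have p6 : P (M - 3) :=
    hs (-2) _ _ p5 (congrFun (oddTable_neg_even (by omega)) 4) (by omega)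
  have c1 : ∀ k : ℤ, P k → k % 2 = 0 → 2 ≤ k → k ≤ M - 3 → P (-k) :=
    fun k hk _ _ _ => hs 0 _ _ hk
      (congrFun (oddTable_pos_even (by omega)) 4) (by omega)
  have c2 : ∀ k : ℤ, P k → k % 2 = 0 → 2 ≤ k → k ≤ M - 3 → P (k - 2) :=
    fun k hk _ _ _ => hs (-2) _ _ (c1 k hk (by omega) (by omega) (by omega))
      (congrFun (oddTable_neg_even (by omega)) 4) (by omega)
  have c : ∀ k : ℤ, k % 2 = 0 → 0 ≤ k → k ≤ M - 3 → P k := fun k _ _ _ =>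
    int_step_down (lo := 0) (hi := M - 3) p6
      (fun k hk _ _ _ => c2 k hk (by omega) (by omega) (by omega)) k
      (by omega) (by omega) (by omega)
  have p7 : P 0 := c _ (by omega) (by omega) (by omega)
  intro b hb1 hb2
  by_contra hb
  have n1 : b ≠ 1 := fun h => hb (h ▸ p1)
  have n2 : b ≠ M := fun h => hb (h ▸ p2)
  have n3 : b ≠ -M := fun h => hb (h ▸ p3)
  have n4 : b ≠ M - 1 := fun h => hb (h ▸ p4)
  have n5 : b ≠ -(M - 1) := fun h => hb (h ▸ p5)
  have n6 : b ≠ M - 3 := fun h => hb (h ▸ p6)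
  have n7 : b ≠ 0 := fun h => hb (h ▸ p7)
  have l1 : ¬((-b) % 2 = 1 ∧ 1 ≤ -b ∧ -b ≤ M - 2) := fun ⟨h1, h2, h3⟩ =>
    hb ((show -(-b) = b by ring) ▸ a1 (-b) (a _ h1 (by omega) (by omega)) h1 h2 h3)
  have l2 : ¬((b - 2) % 2 = 1 ∧ 1 ≤ b - 2 ∧ b - 2 ≤ M - 2) := fun ⟨h1, h2, h3⟩ =>
    hb ((show (b - 2) + 2 = b by ring) ▸ a2 (b - 2) (a _ h1 (by omega) (by omega)) h1 h2 h3)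
  have l3 : ¬((-b) % 2 = 0 ∧ 2 ≤ -b ∧ -b ≤ M - 3) := fun ⟨h1, h2, h3⟩ =>
    hb ((show -(-b) = b by ring) ▸ c1 (-b) (c _ h1 (by omega) (by omega)) h1 h2 h3)
  have l4 : ¬((b + 2) % 2 = 0 ∧ 2 ≤ b + 2 ∧ b + 2 ≤ M - 3) := fun ⟨h1, h2, h3⟩ =>
    hb ((show (b + 2) - 2 = b by ring) ▸ c2 (b + 2) (c _ h1 (by omega) (by omega)) h1 h2 h3)
  omega

/-! ### Orbits of the central cycles, `M` even -/

/-- The blocks are those of the odd case. Only the end near `±M` changes, here to `M - 3, -(M - 1),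
M, -(M - 2), M - 1, -M, ∞`. -/
theorem cyclicMap_evenTable_zero {M : ℕ} (hM : 3 ≤ M) (hpar : M % 2 = 0) :
    CyclicMap (follow M (-2) fun a => evenTable M a 0) := by
  refine cyclicMap_follow (fun P h0 hs => ?_)
    ⟨1, -M, congrFun (evenTable_neg_top (by omega)) 0, by omega⟩
  have p1 : P (-1) := h0 _ (by omega)
  have p2 : P 2 :=
    hs 1 _ _ p1 (congrFun (evenTable_neg_odd (by omega)) 0) (by omega)
  have p3 : P 0 :=
    hs 2 _ _ p2 (evenTable_pos_even_zero (by omega)) (by omega)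
  have p4 : P 1 :=
    hs 1 _ _ p3 (congrFun (evenTable_zero (by omega)) 0) (by omega)
  have a1 : ∀ k : ℤ, P k → k % 2 = 1 → 1 ≤ k → k ≤ M - 5 → P (-(k + 2)) :=
    fun k hk _ _ _ => hs (-2) _ _ hk
      (congrFun (evenTable_pos_odd (by omega)) 0) (by omega)
  have a2 : ∀ k : ℤ, P k → k % 2 = 1 → 1 ≤ k → k ≤ M - 5 → P (k + 3) :=
    fun k hk _ _ _ => hs 1 _ _ (a1 k hk (by omega) (by omega) (by omega))
      (congrFun (evenTable_neg_odd (by omega)) 0) (by omega)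
  have a3 : ∀ k : ℤ, P k → k % 2 = 1 → 1 ≤ k → k ≤ M - 5 → P (-(k + 1)) :=
    fun k hk _ _ _ => hs 2 _ _ (a2 k hk (by omega) (by omega) (by omega))
      (evenTable_pos_even_zero (by omega)) (by omega)
  have a4 : ∀ k : ℤ, P k → k % 2 = 1 → 1 ≤ k → k ≤ M - 5 → P (k + 2) :=
    fun k hk _ _ _ => hs 1 _ _ (a3 k hk (by omega) (by omega) (by omega))
      (congrFun (evenTable_neg_even (by omega)) 0) (by omega)
  have a : ∀ k : ℤ, k % 2 = 1 → 1 ≤ k → k ≤ M - 3 → P k := fun k _ _ _ =>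
    int_step_up (lo := 1) (hi := M - 3) p4
      (fun k hk _ _ _ => a4 k hk (by omega) (by omega) (by omega)) k
      (by omega) (by omega) (by omega)
  have p5 : P (M - 3) := a _ (by omega) (by omega) (by omega)
  have p6 : P (-(M - 1)) :=
    hs (-2) _ _ p5 (congrFun (evenTable_pos_odd (by omega)) 0) (by omega)
  have p7 : P M :=
    hs 1 _ _ p6 (congrFun (evenTable_neg_odd (by omega)) 0) (by omega)
  have p8 : P (-(M - 2)) :=
    hs 2 _ _ p7 (congrFun (evenTable_top (by omega)) 0) (by omega)
  have p9 : P (M - 1) :=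
    hs 1 _ _ p8 (congrFun (evenTable_neg_even (by omega)) 0) (by omega)
  have p10 : P (-M) :=
    hs (-1) _ _ p9 (congrFun (evenTable_top_sub_one (by omega)) 0) (by omega)
  intro b hb1 hb2
  by_contra hb
  have n1 : b ≠ -1 := fun h => hb (h ▸ p1)
  have n2 : b ≠ 2 := fun h => hb (h ▸ p2)
  have n3 : b ≠ 0 := fun h => hb (h ▸ p3)
  have n4 : b ≠ 1 := fun h => hb (h ▸ p4)
  have n5 : b ≠ M - 3 := fun h => hb (h ▸ p5)
  have n6 : b ≠ -(M - 1) := fun h => hb (h ▸ p6)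
  have n7 : b ≠ M := fun h => hb (h ▸ p7)
  have n8 : b ≠ -(M - 2) := fun h => hb (h ▸ p8)
  have n9 : b ≠ M - 1 := fun h => hb (h ▸ p9)
  have n10 : b ≠ -M := fun h => hb (h ▸ p10)
  have l1 : ¬((-b - 2) % 2 = 1 ∧ 1 ≤ -b - 2 ∧ -b - 2 ≤ M - 5) := fun ⟨h1, h2, h3⟩ =>
    hb ((show -((-b - 2) + 2) = b by ring) ▸ a1 (-b - 2) (a _ h1 (by omega) (by omega)) h1 h2 h3)
  have l2 : ¬((b - 3) % 2 = 1 ∧ 1 ≤ b - 3 ∧ b - 3 ≤ M - 5) := fun ⟨h1, h2, h3⟩ =>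
    hb ((show (b - 3) + 3 = b by ring) ▸ a2 (b - 3) (a _ h1 (by omega) (by omega)) h1 h2 h3)
  have l3 : ¬((-b - 1) % 2 = 1 ∧ 1 ≤ -b - 1 ∧ -b - 1 ≤ M - 5) := fun ⟨h1, h2, h3⟩ =>
    hb ((show -((-b - 1) + 1) = b by ring) ▸ a3 (-b - 1) (a _ h1 (by omega) (by omega)) h1 h2 h3)
  have l4 : ¬((b - 2) % 2 = 1 ∧ 1 ≤ b - 2 ∧ b - 2 ≤ M - 5) := fun ⟨h1, h2, h3⟩ =>
    hb ((show (b - 2) + 2 = b by ring) ▸ a4 (b - 2) (a _ h1 (by omega) (by omega)) h1 h2 h3)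
  omega

theorem cyclicMap_evenTable_one {M : ℕ} (hM : 3 ≤ M) (hpar : M % 2 = 0) :
    CyclicMap (follow M (-1) fun a => evenTable M a 1) := by
  refine cyclicMap_follow (fun P h0 hs => ?_)
    ⟨-2, -1, congrFun (evenTable_neg_odd (by omega)) 1, by omega⟩
  have p1 : P M := h0 _ (by omega)
  have p2 : P (-M) :=
    hs 0 _ _ p1 (congrFun (evenTable_top (by omega)) 1) (by omega)
  have p3 : P (M - 1) :=
    hs (-1) _ _ p2 (congrFun (evenTable_neg_top (by omega)) 1) (by omega)
  have p4 : P (-(M - 2)) :=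
    hs 1 _ _ p3 (congrFun (evenTable_top_sub_one (by omega)) 1) (by omega)
  have p5 : P (M - 2) :=
    hs 0 _ _ p4 (congrFun (evenTable_neg_even (by omega)) 1) (by omega)
  have p6 : P (-(M - 1)) :=
    hs (-1) _ _ p5 (congrFun (evenTable_top_sub_two (by omega)) 1) (by omega)
  have p7 : P (M - 3) :=
    hs (-2) _ _ p6 (congrFun (evenTable_neg_odd (by omega)) 1) (by omega)
  have a1 : ∀ k : ℤ, P k → k % 2 = 1 → 3 ≤ k → k ≤ M - 3 → P (-(k - 1)) :=
    fun k hk _ _ _ => hs 1 _ _ hk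
      (congrFun (evenTable_pos_odd (by omega)) 1) (by omega)
  have a2 : ∀ k : ℤ, P k → k % 2 = 1 → 3 ≤ k → k ≤ M - 3 → P (k - 1) :=
    fun k hk _ _ _ => hs 0 _ _ (a1 k hk (by omega) (by omega) (by omega))
      (congrFun (evenTable_neg_even (by omega)) 1) (by omega)
  have a3 : ∀ k : ℤ, P k → k % 2 = 1 → 3 ≤ k → k ≤ M - 3 → P (-k) :=
    fun k hk _ _ _ => hs (-1) _ _ (a2 k hk (by omega) (by omega) (by omega))
      (congrFun (evenTable_pos_even (by omega)) 1) (by omega)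
  have a4 : ∀ k : ℤ, P k → k % 2 = 1 → 3 ≤ k → k ≤ M - 3 → P (k - 2) :=
    fun k hk _ _ _ => hs (-2) _ _ (a3 k hk (by omega) (by omega) (by omega))
      (congrFun (evenTable_neg_odd (by omega)) 1) (by omega)
  have a : ∀ k : ℤ, k % 2 = 1 → 1 ≤ k → k ≤ M - 3 → P k := fun k _ _ _ =>
    int_step_down (lo := 1) (hi := M - 3) p7
      (fun k hk _ _ _ => a4 k hk (by omega) (by omega) (by omega)) k
      (by omega) (by omega) (by omega)
  have p8 : P 1 := a _ (by omega) (by omega) (by omega)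
  have p9 : P 0 :=
    hs 1 _ _ p8 (congrFun (evenTable_pos_odd (by omega)) 1) (by omega)
  have p10 : P (-1) :=
    hs (-1) _ _ p9 (congrFun (evenTable_zero (by omega)) 1) (by omega)
  intro b hb1 hb2
  by_contra hb
  have n1 : b ≠ M := fun h => hb (h ▸ p1)
  have n2 : b ≠ -M := fun h => hb (h ▸ p2)
  have n3 : b ≠ M - 1 := fun h => hb (h ▸ p3)
  have n4 : b ≠ -(M - 2) := fun h => hb (h ▸ p4)
  have n5 : b ≠ M - 2 := fun h => hb (h ▸ p5)
  have n6 : b ≠ -(M - 1) := fun h => hb (h ▸ p6)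
  have n7 : b ≠ M - 3 := fun h => hb (h ▸ p7)
  have n8 : b ≠ 1 := fun h => hb (h ▸ p8)
  have n9 : b ≠ 0 := fun h => hb (h ▸ p9)
  have n10 : b ≠ -1 := fun h => hb (h ▸ p10)
  have l1 : ¬((-b + 1) % 2 = 1 ∧ 3 ≤ -b + 1 ∧ -b + 1 ≤ M - 3) := fun ⟨h1, h2, h3⟩ =>
    hb ((show -((-b + 1) - 1) = b by ring) ▸ a1 (-b + 1) (a _ h1 (by omega) (by omega)) h1 h2 h3)
  have l2 : ¬((b + 1) % 2 = 1 ∧ 3 ≤ b + 1 ∧ b + 1 ≤ M - 3) := fun ⟨h1, h2, h3⟩ =>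
    hb ((show (b + 1) - 1 = b by ring) ▸ a2 (b + 1) (a _ h1 (by omega) (by omega)) h1 h2 h3)
  have l3 : ¬((-b) % 2 = 1 ∧ 3 ≤ -b ∧ -b ≤ M - 3) := fun ⟨h1, h2, h3⟩ =>
    hb ((show -(-b) = b by ring) ▸ a3 (-b) (a _ h1 (by omega) (by omega)) h1 h2 h3)
  have l4 : ¬((b + 2) % 2 = 1 ∧ 3 ≤ b + 2 ∧ b + 2 ≤ M - 3) := fun ⟨h1, h2, h3⟩ =>
    hb ((show (b + 2) - 2 = b by ring) ▸ a4 (b + 2) (a _ h1 (by omega) (by omega)) h1 h2 h3)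
  omega

theorem cyclicMap_evenTable_two {M : ℕ} (hM : 3 ≤ M) (hpar : M % 2 = 0) :
    CyclicMap (follow M 0 fun a => evenTable M a 2) := by
  refine cyclicMap_follow (fun P h0 hs => ?_)
    ⟨-1, M, congrFun (evenTable_top (by omega)) 2, by omega⟩
  have p1 : P 0 := h0 _ (by omega)
  have p2 : P 2 :=
    hs 2 _ _ p1 (congrFun (evenTable_zero (by omega)) 2) (by omega)
  have a1 : ∀ k : ℤ, P k → k % 2 = 0 → 2 ≤ k → k ≤ M - 4 → P (-(k - 1)) :=
    fun k hk _ _ _ => hs 1 _ _ hk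
      (congrFun (evenTable_pos_even (by omega)) 2) (by omega)
  have a2 : ∀ k : ℤ, P k → k % 2 = 0 → 2 ≤ k → k ≤ M - 4 → P (k - 1) :=
    fun k hk _ _ _ => hs 0 _ _ (a1 k hk (by omega) (by omega) (by omega))
      (congrFun (evenTable_neg_odd (by omega)) 2) (by omega)
  have a3 : ∀ k : ℤ, P k → k % 2 = 0 → 2 ≤ k → k ≤ M - 4 → P (-k) :=
    fun k hk _ _ _ => hs (-1) _ _ (a2 k hk (by omega) (by omega) (by omega))
      (congrFun (evenTable_pos_odd (by omega)) 2) (by omega)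
  have a4 : ∀ k : ℤ, P k → k % 2 = 0 → 2 ≤ k → k ≤ M - 4 → P (k + 2) :=
    fun k hk _ _ _ => hs 2 _ _ (a3 k hk (by omega) (by omega) (by omega))
      (congrFun (evenTable_neg_even (by omega)) 2) (by omega)
  have a : ∀ k : ℤ, k % 2 = 0 → 2 ≤ k → k ≤ M - 2 → P k := fun k _ _ _ =>
    int_step_up (lo := 2) (hi := M - 2) p2
      (fun k hk _ _ _ => a4 k hk (by omega) (by omega) (by omega)) k
      (by omega) (by omega) (by omega)
  have p3 : P (M - 2) := a _ (by omega) (by omega) (by omega)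
  have p4 : P (-M) :=
    hs (-2) _ _ p3 (congrFun (evenTable_top_sub_two (by omega)) 2) (by omega)
  have p5 : P (-(M - 1)) :=
    hs 2 _ _ p4 (congrFun (evenTable_neg_top (by omega)) 2) (by omega)
  have p6 : P (M - 1) :=
    hs 0 _ _ p5 (congrFun (evenTable_neg_odd (by omega)) 2) (by omega)
  have p7 : P (-(M - 3)) :=
    hs 2 _ _ p6 (congrFun (evenTable_top_sub_one (by omega)) 2) (by omega)
  have p8 : P (M - 3) :=
    hs 0 _ _ p7 (congrFun (evenTable_neg_odd (by omega)) 2) (by omega)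
  have p9 : P (-(M - 2)) :=
    hs (-1) _ _ p8 (congrFun (evenTable_pos_odd (by omega)) 2) (by omega)
  have p10 : P M :=
    hs 2 _ _ p9 (congrFun (evenTable_neg_even (by omega)) 2) (by omega)
  intro b hb1 hb2
  by_contra hb
  have n1 : b ≠ 0 := fun h => hb (h ▸ p1)
  have n2 : b ≠ 2 := fun h => hb (h ▸ p2)
  have n3 : b ≠ M - 2 := fun h => hb (h ▸ p3)
  have n4 : b ≠ -M := fun h => hb (h ▸ p4)
  have n5 : b ≠ -(M - 1) := fun h => hb (h ▸ p5)
  have n6 : b ≠ M - 1 := fun h => hb (h ▸ p6)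
  have n7 : b ≠ -(M - 3) := fun h => hb (h ▸ p7)
  have n8 : b ≠ M - 3 := fun h => hb (h ▸ p8)
  have n9 : b ≠ -(M - 2) := fun h => hb (h ▸ p9)
  have n10 : b ≠ M := fun h => hb (h ▸ p10)
  have l1 : ¬((-b + 1) % 2 = 0 ∧ 2 ≤ -b + 1 ∧ -b + 1 ≤ M - 4) := fun ⟨h1, h2, h3⟩ =>
    hb ((show -((-b + 1) - 1) = b by ring) ▸ a1 (-b + 1) (a _ h1 (by omega) (by omega)) h1 h2 h3)
  have l2 : ¬((b + 1) % 2 = 0 ∧ 2 ≤ b + 1 ∧ b + 1 ≤ M - 4) := fun ⟨h1, h2, h3⟩ =>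
    hb ((show (b + 1) - 1 = b by ring) ▸ a2 (b + 1) (a _ h1 (by omega) (by omega)) h1 h2 h3)
  have l3 : ¬((-b) % 2 = 0 ∧ 2 ≤ -b ∧ -b ≤ M - 4) := fun ⟨h1, h2, h3⟩ =>
    hb ((show -(-b) = b by ring) ▸ a3 (-b) (a _ h1 (by omega) (by omega)) h1 h2 h3)
  have l4 : ¬((b - 2) % 2 = 0 ∧ 2 ≤ b - 2 ∧ b - 2 ≤ M - 4) := fun ⟨h1, h2, h3⟩ =>
    hb ((show (b - 2) + 2 = b by ring) ▸ a4 (b - 2) (a _ h1 (by omega) (by omega)) h1 h2 h3)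
  omega

theorem cyclicMap_evenTable_three {M : ℕ} (hM : 3 ≤ M) (hpar : M % 2 = 0) :
    CyclicMap (follow M 1 fun a => evenTable M a 3) := by
  refine cyclicMap_follow (fun P h0 hs => ?_)
    ⟨2, 1, congrFun (evenTable_pos_odd (by omega)) 3, by omega⟩
  have p1 : P (-M) := h0 _ (by omega)
  have p2 : P M :=
    hs 0 _ _ p1 (congrFun (evenTable_neg_top (by omega)) 3) (by omega)
  have p3 : P (M - 1) :=
    hs (-2) _ _ p2 (congrFun (evenTable_top (by omega)) 3) (by omega)
  have p4 : P (-(M - 1)) :=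
    hs 0 _ _ p3 (congrFun (evenTable_top_sub_one (by omega)) 3) (by omega)
  have p5 : P (M - 2) :=
    hs (-1) _ _ p4 (congrFun (evenTable_neg_odd (by omega)) 3) (by omega)
  have p6 : P (-(M - 3)) :=
    hs 1 _ _ p5 (congrFun (evenTable_top_sub_two (by omega)) 3) (by omega)
  have a1 : ∀ k : ℤ, P (-k) → k % 2 = 1 → 3 ≤ k → k ≤ M - 3 → P (k - 1) :=
    fun k hk _ _ _ => hs (-1) _ _ hk
      (congrFun (evenTable_neg_odd (by omega)) 3) (by omega)
  have a2 : ∀ k : ℤ, P (-k) → k % 2 = 1 → 3 ≤ k → k ≤ M - 3 → P (-(k + 1)) :=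
    fun k hk _ _ _ => hs (-2) _ _ (a1 k hk (by omega) (by omega) (by omega))
      (congrFun (evenTable_pos_even (by omega)) 3) (by omega)
  have a3 : ∀ k : ℤ, P (-k) → k % 2 = 1 → 3 ≤ k → k ≤ M - 3 → P k :=
    fun k hk _ _ _ => hs (-1) _ _ (a2 k hk (by omega) (by omega) (by omega))
      (congrFun (evenTable_neg_even (by omega)) 3) (by omega)
  have a4 : ∀ k : ℤ, P (-k) → k % 2 = 1 → 3 ≤ k → k ≤ M - 3 → P (-(k - 2)) :=
    fun k hk _ _ _ => hs 2 _ _ (a3 k hk (by omega) (by omega) (by omega))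
      (congrFun (evenTable_pos_odd (by omega)) 3) (by omega)
  have a : ∀ k : ℤ, k % 2 = 1 → 1 ≤ k → k ≤ M - 3 → P (-k) := fun k _ _ _ =>
    int_step_down (P := fun k => P (-k)) (lo := 1) (hi := M - 3) p6
      (fun k hk _ _ _ => a4 k hk (by omega) (by omega) (by omega)) k
      (by omega) (by omega) (by omega)
  have p7 : P (-1) := a 1 (by omega) (by omega) (by omega)
  have p8 : P 0 :=
    hs (-1) _ _ p7 (congrFun (evenTable_neg_odd (by omega)) 3) (by omega)
  have p9 : P (-2) :=
    hs (-2) _ _ p8 (congrFun (evenTable_zero (by omega)) 3) (by omega)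
  have p10 : P 1 :=
    hs (-1) _ _ p9 (congrFun (evenTable_neg_even (by omega)) 3) (by omega)
  intro b hb1 hb2
  by_contra hb
  have n1 : b ≠ -M := fun h => hb (h ▸ p1)
  have n2 : b ≠ M := fun h => hb (h ▸ p2)
  have n3 : b ≠ M - 1 := fun h => hb (h ▸ p3)
  have n4 : b ≠ -(M - 1) := fun h => hb (h ▸ p4)
  have n5 : b ≠ M - 2 := fun h => hb (h ▸ p5)
  have n6 : b ≠ -(M - 3) := fun h => hb (h ▸ p6)
  have n7 : b ≠ -1 := fun h => hb (h ▸ p7)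
  have n8 : b ≠ 0 := fun h => hb (h ▸ p8)
  have n9 : b ≠ -2 := fun h => hb (h ▸ p9)
  have n10 : b ≠ 1 := fun h => hb (h ▸ p10)
  have l1 : ¬((b + 1) % 2 = 1 ∧ 3 ≤ b + 1 ∧ b + 1 ≤ M - 3) := fun ⟨h1, h2, h3⟩ =>
    hb ((show (b + 1) - 1 = b by ring) ▸ a1 (b + 1) (a _ h1 (by omega) (by omega)) h1 h2 h3)
  have l2 : ¬((-b - 1) % 2 = 1 ∧ 3 ≤ -b - 1 ∧ -b - 1 ≤ M - 3) := fun ⟨h1, h2, h3⟩ =>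
    hb ((show -((-b - 1) + 1) = b by ring) ▸ a2 (-b - 1) (a _ h1 (by omega) (by omega)) h1 h2 h3)
  have l3 : ¬((b) % 2 = 1 ∧ 3 ≤ b ∧ b ≤ M - 3) := fun ⟨h1, h2, h3⟩ =>
    hb ((show (b) = b by ring) ▸ a3 (b) (a _ h1 (by omega) (by omega)) h1 h2 h3)
  have l4 : ¬((-b + 2) % 2 = 1 ∧ 3 ≤ -b + 2 ∧ -b + 2 ≤ M - 3) := fun ⟨h1, h2, h3⟩ =>
    hb ((show -((-b + 2) - 2) = b by ring) ▸ a4 (-b + 2) (a _ h1 (by omega) (by omega)) h1 h2 h3)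
  omega

theorem cyclicMap_evenTable_four {M : ℕ} (hM : 3 ≤ M) (hpar : M % 2 = 0) :
    CyclicMap (follow M 2 fun a => evenTable M a 4) := by
  refine cyclicMap_follow (fun P h0 hs => ?_)
    ⟨0, 0, congrFun (evenTable_zero (by omega)) 4, by omega⟩
  have p1 : P 1 := h0 _ (by omega)
  have a1 : ∀ k : ℤ, P k → k % 2 = 1 → 1 ≤ k → k ≤ M - 3 → P (-k) :=
    fun k hk _ _ _ => hs 0 _ _ hk
      (congrFun (evenTable_pos_odd (by omega)) 4) (by omega)
  have a2 : ∀ k : ℤ, P k → k % 2 = 1 → 1 ≤ k → k ≤ M - 3 → P (k + 2) :=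
    fun k hk _ _ _ => hs 2 _ _ (a1 k hk (by omega) (by omega) (by omega))
      (congrFun (evenTable_neg_odd (by omega)) 4) (by omega)
  have a : ∀ k : ℤ, k % 2 = 1 → 1 ≤ k → k ≤ M - 1 → P k := fun k _ _ _ =>
    int_step_up (lo := 1) (hi := M - 1) p1
      (fun k hk _ _ _ => a2 k hk (by omega) (by omega) (by omega)) k
      (by omega) (by omega) (by omega)
  have p2 : P (M - 1) := a _ (by omega) (by omega) (by omega)
  have p3 : P M :=
    hs (-2) _ _ p2 (congrFun (evenTable_top_sub_one (by omega)) 4) (by omega)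
  have p4 : P (-(M - 1)) :=
    hs 1 _ _ p3 (congrFun (evenTable_top (by omega)) 4) (by omega)
  have p5 : P (-M) :=
    hs 2 _ _ p4 (congrFun (evenTable_neg_odd (by omega)) 4) (by omega)
  have p6 : P (M - 2) :=
    hs (-2) _ _ p5 (congrFun (evenTable_neg_top (by omega)) 4) (by omega)
  have p7 : P (-(M - 2)) :=
    hs 0 _ _ p6 (congrFun (evenTable_top_sub_two (by omega)) 4) (by omega)
  have p8 : P (M - 4) :=
    hs (-2) _ _ p7 (congrFun (evenTable_neg_even (by omega)) 4) (by omega)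
  have c1 : ∀ k : ℤ, P k → k % 2 = 0 → 2 ≤ k → k ≤ M - 4 → P (-k) :=
    fun k hk _ _ _ => hs 0 _ _ hk
      (congrFun (evenTable_pos_even (by omega)) 4) (by omega)
  have c2 : ∀ k : ℤ, P k → k % 2 = 0 → 2 ≤ k → k ≤ M - 4 → P (k - 2) :=
    fun k hk _ _ _ => hs (-2) _ _ (c1 k hk (by omega) (by omega) (by omega))
      (congrFun (evenTable_neg_even (by omega)) 4) (by omega)
  have c : ∀ k : ℤ, k % 2 = 0 → 0 ≤ k → k ≤ M - 4 → P k := fun k _ _ _ =>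
    int_step_down (lo := 0) (hi := M - 4) p8
      (fun k hk _ _ _ => c2 k hk (by omega) (by omega) (by omega)) k
      (by omega) (by omega) (by omega)
  have p9 : P 0 := c _ (by omega) (by omega) (by omega)
  intro b hb1 hb2
  by_contra hb
  have n1 : b ≠ 1 := fun h => hb (h ▸ p1)
  have n2 : b ≠ M - 1 := fun h => hb (h ▸ p2)
  have n3 : b ≠ M := fun h => hb (h ▸ p3)
  have n4 : b ≠ -(M - 1) := fun h => hb (h ▸ p4)
  have n5 : b ≠ -M := fun h => hb (h ▸ p5)
  have n6 : b ≠ M - 2 := fun h => hb (h ▸ p6)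
  have n7 : b ≠ -(M - 2) := fun h => hb (h ▸ p7)
  have n8 : b ≠ M - 4 := fun h => hb (h ▸ p8)
  have n9 : b ≠ 0 := fun h => hb (h ▸ p9)
  have l1 : ¬((-b) % 2 = 1 ∧ 1 ≤ -b ∧ -b ≤ M - 3) := fun ⟨h1, h2, h3⟩ =>
    hb ((show -(-b) = b by ring) ▸ a1 (-b) (a _ h1 (by omega) (by omega)) h1 h2 h3)
  have l2 : ¬((b - 2) % 2 = 1 ∧ 1 ≤ b - 2 ∧ b - 2 ≤ M - 3) := fun ⟨h1, h2, h3⟩ =>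
    hb ((show (b - 2) + 2 = b by ring) ▸ a2 (b - 2) (a _ h1 (by omega) (by omega)) h1 h2 h3)
  have l3 : ¬((-b) % 2 = 0 ∧ 2 ≤ -b ∧ -b ≤ M - 4) := fun ⟨h1, h2, h3⟩ =>
    hb ((show -(-b) = b by ring) ▸ c1 (-b) (c _ h1 (by omega) (by omega)) h1 h2 h3)
  have l4 : ¬((b + 2) % 2 = 0 ∧ 2 ≤ b + 2 ∧ b + 2 ≤ M - 4) := fun ⟨h1, h2, h3⟩ =>
    hb ((show (b + 2) - 2 = b by ring) ▸ c2 (b + 2) (c _ h1 (by omega) (by omega)) h1 h2 h3)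
  omega

/-! ### Central cycles, zigzags and the decomposition for even order -/

/-- Five cyclic maps which together use the matchings numbered `-2, …, 2`. -/
def centralMap (M : ℕ) (c : Fin 5) : Option (ZMod (2 * M + 1)) → Option (ZMod (2 * M + 1)) :=
  follow M (![-2, -1, 0, 1, 2] c) fun a =>
    if M % 2 = 1 then oddTable M a c else evenTable M a c

theorem cyclicMap_centralMap {M : ℕ} (hM : 3 ≤ M) (c : Fin 5) : CyclicMap (centralMap M c) := by
  unfold centralMap
  by_cases h : M % 2 = 1
  · simp only [h, if_true]
    fin_cases c
    · exact cyclicMap_oddTable_zero hM h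
    · exact cyclicMap_oddTable_one hM h
    · exact cyclicMap_oddTable_two hM h
    · exact cyclicMap_oddTable_three hM h
    · exact cyclicMap_oddTable_four hM h
  · simp only [h, if_false]
    have h : M % 2 = 0 := by omega
    fin_cases c
    · exact cyclicMap_evenTable_zero hM h
    · exact cyclicMap_evenTable_one hM h
    · exact cyclicMap_evenTable_two hM h
    · exact cyclicMap_evenTable_three hM h
    · exact cyclicMap_evenTable_four hM h

/-- The cycle through the matchings `0` and `1`, in one of its two directions. -/
def zigzag (M : ℕ) (d : Bool) : Option (ZMod (2 * M + 1)) → Option (ZMod (2 * M + 1)) :=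
  follow M (if d then 0 else 1) fun a => if decide (0 < a) = d then 0 else 1

/-- For `d = true` the orbit is `∞, 0, 1, -1, 2, -2, …, M, -M, ∞`; for `d = false` it is traversed
backwards. -/
theorem cyclicMap_zigzag (M : ℕ) (d : Bool) : CyclicMap (zigzag M d) := by
  cases d
  · refine cyclicMap_follow (fun P h0 hs => ?_) ⟨0, 0, by simp, by omega⟩
    have key : ∀ k : ℕ, k ≤ M → P (-(M - k : ℤ)) ∧ P (M - k) := by
      intro k
      induction k with
      | zero =>
        intro _
        have h : P (-(M - (0 : ℕ) : ℤ)) := h0 _ (by simp)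
        rcases Nat.eq_zero_or_pos M with rfl | hM
        · exact ⟨h, by simpa using h⟩
        · exact ⟨h, hs 0 _ _ h (by simp) (by push_cast; omega)⟩
      | succ k ih =>
        intro hk
        have h : P (-(M - (k + 1 : ℕ) : ℤ)) :=
          hs 1 _ _ (ih (by omega)).2 (by simp; omega) (by push_cast; omega)
        refine ⟨h, ?_⟩
        rcases Nat.eq_or_lt_of_le hk with hk | hk
        · convert h using 1
          omega
        · exact hs 0 _ _ h (by simp; omega) (by push_cast; omega)
    intro b hb1 hb2
    rcases le_total 0 b with hb | hb
    · convert (key (M - b).toNat (by omega)).2 using 1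
      omega
    · convert (key (M + b).toNat (by omega)).1 using 1
      omega
  · refine cyclicMap_follow (fun P h0 hs => ?_) ⟨1, -M, by simp, by omega⟩
    have p0 : P 0 := h0 _ (by simp)
    have key : ∀ k : ℕ, k ≤ M → P k ∧ P (-k) := by
      intro k
      induction k with
      | zero => intro _; simpa using p0
      | succ k ih =>
        intro hk
        have h : P (k + 1 : ℕ) :=
          hs 1 _ _ (ih (by omega)).2 (by simp) (by push_cast; omega)
        exact ⟨h, hs 0 _ _ h (by simp) (by push_cast; omega)⟩
    intro b hb1 hb2
    rcases le_total 0 b with hb | hb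
    · convert (key b.toNat (by omega)).1 using 1
      omega
    · convert (key (-b).toNat (by omega)).2 using 1
      omega

/-- `zigzag M d` translated by `r`. -/
def rotatedZigzag (M : ℕ) (r : ZMod (2 * M + 1)) (d : Bool) (v : Option (ZMod (2 * M + 1))) :
    Option (ZMod (2 * M + 1)) :=
  shiftFinite r (zigzag M d ((shiftFinite r).symm v))

theorem cyclicMap_rotatedZigzag (M : ℕ) (r : ZMod (2 * M + 1)) (d : Bool) :
    CyclicMap (rotatedZigzag M r d) :=
  (cyclicMap_zigzag M d).conj (shiftFinite r)

/-- The matching followed by `zigzag M d`. -/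
def zigzagNumber (M : ℕ) (d : Bool) (v : Option (ZMod (2 * M + 1))) : ℤ :=
  v.elim (if d then 0 else 1) fun x => if decide (0 < x.valMinAbs) = d then 0 else 1

theorem zigzagNumber_mem {M : ℕ} (d : Bool) (v : Option (ZMod (2 * M + 1))) :
    0 ≤ zigzagNumber M d v ∧ zigzagNumber M d v ≤ 1 := by
  cases v <;> simp only [zigzagNumber, Option.elim] <;> split_ifs <;> simp

theorem zigzagNumber_injective {M : ℕ} (v : Option (ZMod (2 * M + 1))) :
    Function.Injective fun d => zigzagNumber M d v := by
  intro d e h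
  cases v <;> cases d <;> cases e <;> simp [zigzagNumber] at h ⊢ <;> omega

theorem rotatedZigzag_eq_pairing {M : ℕ} (r : ZMod (2 * M + 1)) (d : Bool)
    (v : Option (ZMod (2 * M + 1))) :
    rotatedZigzag M r d v =
      pairing
        (((zigzagNumber M d ((shiftFinite r).symm v) : ℤ) : ZMod (2 * M + 1)) + (r + r)) v := by
  conv_rhs => rw [← (shiftFinite r).apply_symm_apply v, pairing_shiftFinite, Equiv.symm_apply_apply]
  rfl

/-- Confining the numbers to `2 * M + 1` consecutive integers makes distinct integers distinct
residues, and distinct residues give distinct arcs by `pairing_injective`. -/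
theorem isCyclicFactorization_of_label {M : ℕ} {ι : Type*}
    {f : ι → Option (ZMod (2 * M + 1)) → Option (ZMod (2 * M + 1))} (hf : ∀ i, CyclicMap (f i))
    (label : ι → Option (ZMod (2 * M + 1)) → ℤ) (c : ℤ)
    (heq : ∀ i v, f i v = pairing (label i v : ZMod (2 * M + 1)) v)
    (hmem : ∀ i v, c ≤ label i v ∧ label i v ≤ c + 2 * M)
    (hinj : ∀ v, Function.Injective fun i => label i v) : IsCyclicFactorization f := by
  refine ⟨hf, fun v i j hij => hinj v ?_⟩
  simp only [heq] at hij ⊢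
  have h := pairing_injective v hij
  rw [ZMod.intCast_eq_intCast_iff_dvd_sub] at h
  have h1 := hmem i v
  have h2 := hmem j v
  have := Int.eq_zero_of_abs_lt_dvd h (by rw [abs_lt]; push_cast; omega)
  omega

/-- Rotation by `i` uses the matchings `2 * i` and `2 * i + 1`. Together these are `0, …, 2 * M -
1`; the matching `2 * M` stays unused. -/
theorem isCyclicFactorization_rotatedZigzag (M : ℕ) :
    IsCyclicFactorization fun (i : Fin M × Bool) => rotatedZigzag M (i.1 : ℕ) i.2 := by
  refine isCyclicFactorization_of_label (fun i => cyclicMap_rotatedZigzag _ _ _)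
    (fun i v => zigzagNumber M i.2 ((shiftFinite (i.1 : ℕ)).symm v) + 2 * (i.1 : ℕ)) 0
    (fun i v => ?_) (fun i v => ?_) (fun v i j hij => ?_)
  · rw [rotatedZigzag_eq_pairing]
    congr 1
    push_cast
    ring
  · have := zigzagNumber_mem i.2 ((shiftFinite (i.1 : ℕ)).symm v)
    have := i.1.2
    omega
  · obtain ⟨i, d⟩ := i
    obtain ⟨j, e⟩ := j
    have h1 := zigzagNumber_mem d ((shiftFinite (i : ℕ)).symm v)
    have h2 := zigzagNumber_mem e ((shiftFinite (j : ℕ)).symm v)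
    dsimp only at hij
    obtain rfl : i = j := by ext; omega
    rw [zigzagNumber_injective _ (add_right_cancel hij)]

/-- The matching followed by `centralMap M c`. -/
def centralNumber (M : ℕ) (v : Option (ZMod (2 * M + 1))) : Fin 5 → ℤ :=
  v.elim ![-2, -1, 0, 1, 2] fun x =>
    if M % 2 = 1 then oddTable M x.valMinAbs else evenTable M x.valMinAbs

/-- Every row of the tables, and the row at infinity, is a permutation of `-2, …, 2`. -/
theorem centralNumber_props {M : ℕ} (v : Option (ZMod (2 * M + 1))) :
    Function.Injective (centralNumber M v) ∧
      ∀ c, -2 ≤ centralNumber M v c ∧ centralNumber M v c ≤ 2 := by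
  cases v <;> simp only [centralNumber, oddTable, evenTable, innerTable, Option.elim]
  · decide
  · split_ifs <;> decide

theorem centralMap_eq_pairing {M : ℕ} (c : Fin 5) (v : Option (ZMod (2 * M + 1))) :
    centralMap M c v = pairing ((centralNumber M v c : ℤ) : ZMod (2 * M + 1)) v := by
  cases v
  · rfl
  · simp only [centralMap, follow, centralNumber, Option.elim]
    split_ifs <;> rfl

/-- Tillson's theorem: the complete digraph on `2 * M + 2 ≥ 8` vertices decomposes into
hamiltonian cycles. -/
theorem isCyclicFactorization_tillson {M : ℕ} (hM : 3 ≤ M) :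
    IsCyclicFactorization (Sum.elim (centralMap M) fun (i : Fin (M - 2) × Bool) =>
      rotatedZigzag M ((M + 2 + i.1 : ℕ) : ZMod (2 * M + 1)) i.2) := by
  -- Modulo `2 * M + 1` one has `2 * (M + 2 + i) = 3 + 2 * i`, so the rotated zigzags use exactly
  -- the matchings `3, …, 2 * M - 2`, which with `-2, …, 2` fill the window starting at `-2`.
  refine isCyclicFactorization_of_label ?_
    (fun i v => Sum.elim (centralNumber M v) (fun i : Fin (M - 2) × Bool => zigzagNumber M i.2
      ((shiftFinite ((M + 2 + i.1 : ℕ) : ZMod (2 * M + 1))).symm v) + (3 + 2 * (i.1 : ℕ))) i)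
    (-2) ?_ ?_ ?_
  · rintro (c | i)
    · exact cyclicMap_centralMap hM c
    · exact cyclicMap_rotatedZigzag _ _ _
  · rintro (c | i) v
    · exact centralMap_eq_pairing c v
    · simp only [Sum.elim_inr, rotatedZigzag_eq_pairing]
      congr 1
      have : ((2 * M + 1 : ℕ) : ZMod (2 * M + 1)) = 0 := ZMod.natCast_self _
      push_cast at this ⊢
      linear_combination this
  · rintro (c | i) v
    · have := (centralNumber_props v).2 c
      simp only [Sum.elim_inl]
      omega
    · have := zigzagNumber_mem i.2 ((shiftFinite ((M + 2 + i.1 : ℕ) : ZMod (2 * M + 1))).symm v)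
      have := i.1.2
      simp only [Sum.elim_inr]
      omega
  · rintro v (c | ⟨i, d⟩) (c' | ⟨j, e⟩) h
    · exact congrArg _ ((centralNumber_props v).1 h)
    · have h1 := (centralNumber_props v).2 c
      have h2 := zigzagNumber_mem e ((shiftFinite ((M + 2 + j : ℕ) : ZMod (2 * M + 1))).symm v)
      simp only [Sum.elim_inl, Sum.elim_inr] at h
      omega
    · have h1 := (centralNumber_props v).2 c'
      have h2 := zigzagNumber_mem d ((shiftFinite ((M + 2 + i : ℕ) : ZMod (2 * M + 1))).symm v)
      simp only [Sum.elim_inl, Sum.elim_inr] at h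
      omega
    · have h1 := zigzagNumber_mem d ((shiftFinite ((M + 2 + i : ℕ) : ZMod (2 * M + 1))).symm v)
      have h2 := zigzagNumber_mem e ((shiftFinite ((M + 2 + j : ℕ) : ZMod (2 * M + 1))).symm v)
      simp only [Sum.elim_inr] at h
      obtain rfl : i = j := by ext; omega
      rw [zigzagNumber_injective _ (add_right_cancel h)]

/-! ### The decomposition for odd order -/

/-- The zigzag `∞, 0, 1, -1, 2, -2, …, m` on the residues modulo `2 * m` and infinity. -/
def evenZigzag (m : ℕ) (v : Option (ZMod (2 * m))) : Option (ZMod (2 * m)) :=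
  v.elim (some 0) fun x => if x.valMinAbs = m then none
    else some ((if 0 < x.valMinAbs then -x.valMinAbs else 1 - x.valMinAbs : ℤ) : ZMod (2 * m))

theorem valMinAbs_intCast_even {m : ℕ} {a : ℤ} (h1 : -m < a) (h2 : a ≤ m) :
    (a : ZMod (2 * m)).valMinAbs = a := by
  have : NeZero (2 * m) := ⟨by omega⟩
  rw [ZMod.valMinAbs_spec]
  refine ⟨rfl, ?_, ?_⟩ <;> push_cast <;> omega

theorem valMinAbs_even_mem {m : ℕ} (hm : m ≠ 0) (x : ZMod (2 * m)) :
    -(m : ℤ) < x.valMinAbs ∧ x.valMinAbs ≤ m := by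
  have : NeZero (2 * m) := ⟨by omega⟩
  have := ZMod.valMinAbs_mem_Ioc x
  rw [Set.mem_Ioc] at this
  push_cast at this
  omega

theorem cyclicMap_evenZigzag {m : ℕ} (hm : m ≠ 0) : CyclicMap (evenZigzag m) := by
  have hstep : ∀ a b : ℤ, -m < a → a < m → b = (if 0 < a then -a else 1 - a) →
      evenZigzag m (some (a : ZMod (2 * m))) = some (b : ZMod (2 * m)) := by
    rintro a b h1 h2 rfl
    simp only [evenZigzag, Option.elim, valMinAbs_intCast_even h1 h2.le]
    rw [if_neg h2.ne]
  have hnext : ∀ (k : ℕ) v w, (evenZigzag m)^[k] none = v → evenZigzag m v = w →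
      (evenZigzag m)^[k + 1] none = w := by
    rintro k v w rfl rfl
    rw [Function.iterate_succ_apply']
  have key : ∀ k : ℕ, k < m →
      (evenZigzag m)^[2 * k + 1] none = some ((-k : ℤ) : ZMod (2 * m)) ∧
      (evenZigzag m)^[2 * k + 2] none = some ((k + 1 : ℤ) : ZMod (2 * m)) := by
    intro k hk
    have hodd : (evenZigzag m)^[2 * k + 1] none = some ((-k : ℤ) : ZMod (2 * m)) := by
      induction k with
      | zero => simp [evenZigzag]
      | succ k ih =>
        have h := hnext _ _ _ (ih (by omega)) (hstep _ (k + 1) (by omega) (by omega)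
          (by split_ifs <;> omega))
        exact hnext _ _ _ h (hstep _ _ (by omega) (by omega) (by split_ifs <;> push_cast <;> omega))
    exact ⟨hodd, hnext _ _ _ hodd (hstep _ _ (by omega) (by omega) (by split_ifs <;> omega))⟩
  refine CyclicMap.of_forall_reach none ?_ ⟨some ((m : ℤ) : ZMod (2 * m)), ?_⟩
  · rintro (_ | x)
    · exact ⟨0, rfl⟩
    · obtain ⟨h1, h2⟩ := valMinAbs_even_mem hm x
      rw [← ZMod.coe_valMinAbs x]
      rcases le_or_gt x.valMinAbs 0 with h | h
      · refine ⟨_, (key (-x.valMinAbs).toNat (by omega)).1.trans ?_⟩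
        congr 2
        omega
      · refine ⟨_, (key (x.valMinAbs - 1).toNat (by omega)).2.trans ?_⟩
        congr 2
        omega
  · simp only [evenZigzag, Option.elim, valMinAbs_intCast_even (by omega : -(m : ℤ) < m) le_rfl,
      if_true]

/-- The differences along the finite arcs are `-2x` for `0 < x < m` and `1 - 2x` for `-m < x ≤ 0`:
every nonzero residue modulo `2 * m`, once each. Hence an arc between residues determines the
translate containing it. -/
theorem isCyclicFactorization_evenZigzag {m : ℕ} (hm : m ≠ 0) :
    IsCyclicFactorization fun (r : ZMod (2 * m)) v =>
      shiftFinite r (evenZigzag m ((shiftFinite r).symm v)) := by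
  refine ⟨fun r => (cyclicMap_evenZigzag hm).conj _, ?_⟩
  rintro (_ | x) r t h
  · simpa [shiftFinite_none, shiftFinite_symm_none, shiftFinite_some, evenZigzag] using h
  · have h1 := valMinAbs_even_mem hm (x - r)
    have h2 := valMinAbs_even_mem hm (x - t)
    have hr : r = x - ((x - r).valMinAbs : ZMod (2 * m)) := by rw [ZMod.coe_valMinAbs]; ring
    have ht : t = x - ((x - t).valMinAbs : ZMod (2 * m)) := by rw [ZMod.coe_valMinAbs]; ring
    simp only [shiftFinite_symm_some, evenZigzag, Option.elim] at h
    generalize (x - r).valMinAbs = a at *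
    generalize (x - t).valMinAbs = b at *
    subst hr ht
    suffices hab : a = b by rw [hab]
    by_cases ha : a = m <;> by_cases hb : b = m
    · rw [ha, hb]
    · simp [ha, hb, shiftFinite_none, shiftFinite_some] at h
    · simp [ha, hb, shiftFinite_none, shiftFinite_some] at h
    · simp only [if_neg ha, if_neg hb, shiftFinite_some, Option.some.injEq] at h
      have h : (((if 0 < a then -a else 1 - a) - a : ℤ) : ZMod (2 * m)) =
          (((if 0 < b then -b else 1 - b) - b : ℤ) : ZMod (2 * m)) := by
        rw [Int.cast_sub, Int.cast_sub]
        linear_combination h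
      rw [ZMod.intCast_eq_intCast_iff_dvd_sub] at h
      obtain ⟨s, hs⟩ := h
      push_cast at hs
      rw [mul_assoc] at hs
      have hdvd : (m : ℤ) ∣ m * s := ⟨s, rfl⟩
      generalize (m : ℤ) * s = u at *
      -- Equal differences modulo `2 * m` have equal parity, so both come from the same branch,
      -- where integers differ by less than `2 * m`.
      have hu : |u| < m := by
        rw [abs_lt]
        split_ifs at hs <;> omega
      have := Int.eq_zero_of_abs_lt_dvd hdvd hu
      split_ifs at hs <;> omega

/-! ### No decomposition on four or six vertices -/

theorem CyclicMap.exists_equiv {V : Type*} [Fintype V] {n : ℕ} [NeZero n]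
    (hn : Fintype.card V = n) {f : V → V} (hf : CyclicMap f) (o : V) :
    ∃ e : Fin n ≃ V, e 0 = o ∧ ∀ k, f (e k) = e (k + 1) := by
  obtain ⟨d, hd⟩ := hf (f o) o
  have hper : o ∈ Function.periodicPts f :=
    ⟨d + 1, d.succ_pos, by rwa [← Function.iterate_succ_apply] at hd⟩
  have hpos := Function.minimalPeriod_pos_of_mem_periodicPts hper
  have hbij : Function.Bijective fun k : Fin (Function.minimalPeriod f o) => f^[k] o := by
    refine ⟨fun a b hab => Fin.ext (Function.iterate_injOn_Iio_minimalPeriod a.2 b.2 hab),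
      fun v => ?_⟩
    obtain ⟨k, rfl⟩ := hf o v
    exact ⟨⟨_, Nat.mod_lt k hpos⟩, Function.iterate_mod_minimalPeriod_eq⟩
  have hp : Function.minimalPeriod f o = n := by
    rw [← hn, ← Fintype.card_of_bijective hbij, Fintype.card_fin]
  subst hp
  refine ⟨Equiv.ofBijective _ hbij, by simp, fun k => ?_⟩
  simp only [Equiv.ofBijective_apply]
  rw [← Function.iterate_succ_apply' f, Fin.val_add, Fin.val_one', Nat.add_mod_mod,
    Function.iterate_mod_minimalPeriod_eq]

theorem IsCyclicFactorization.exists_apply_eq {V : Type*} [Fintype V] [Nontrivial V] {p : ℕ}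
    (hp : p + 1 = Fintype.card V) {f : Fin p → V → V} (hf : IsCyclicFactorization f) {v w : V}
    (h : w ≠ v) : ∃ i, f i v = w := by
  classical
  have hb : Function.Bijective fun i => (⟨f i v, (hf.1 i).apply_ne v⟩ : {z // z ≠ v}) := by
    rw [Fintype.bijective_iff_injective_and_card]
    refine ⟨fun i j hij => hf.2 v (congrArg Subtype.val hij), ?_⟩
    simp [← hp]
  obtain ⟨i, hi⟩ := hb.2 ⟨w, h⟩
  exact ⟨i, congrArg Subtype.val hi⟩

/-- If the first cycle of a decomposition is normalized to `k ↦ k + 1`, each other one is a tour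
`0, y, …` for some `y ≠ 0, 1`. -/
theorem IsCyclicFactorization.exists_tours {p : ℕ} {f : Fin (p + 1) → Fin (p + 2) → Fin (p + 2)}
    (hf : IsCyclicFactorization f) :
    ∃ s : Fin (p + 2) → Fin (p + 2) → Fin (p + 2),
      (∀ y, y ≠ 0 → y ≠ 1 → s y 0 = 0 ∧ s y 1 = y ∧ Function.Injective (s y) ∧
        ∀ k, s y (k + 1) ≠ s y k + 1) ∧
      ∀ y z, y ≠ 0 → y ≠ 1 → z ≠ 0 → z ≠ 1 → y ≠ z →
        ∀ k l, s y k = s z l → s y (k + 1) ≠ s z (l + 1) := by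
  obtain ⟨e, -, he⟩ := (hf.1 0).exists_equiv (Fintype.card_fin _) 0
  have hg := hf.conj e.symm
  have hg0 : ∀ k, e.symm (f 0 (e.symm.symm k)) = k + 1 := by
    intro k
    rw [Equiv.symm_symm, he, Equiv.symm_apply_apply]
  generalize hgdef : (fun i w => e.symm (f i (e.symm.symm w))) = g at hg
  have hg0 : ∀ k, g 0 k = k + 1 := by rw [← hgdef]; exact hg0
  -- Cycles are indexed by the vertex `y` they visit after `0`; `y = 1` belongs to the normalized
  -- cycle.
  have hex : ∀ y : Fin (p + 2), y ≠ 0 → ∃ i, g i 0 = y :=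
    fun y hy => hg.exists_apply_eq (by simp) hy
  choose! c hc using hex
  have htour : ∀ y : Fin (p + 2), ∃ s : Fin (p + 2) ≃ Fin (p + 2), s 0 = 0 ∧
      ∀ k, g (c y) (s k) = s (k + 1) :=
    fun y => (hg.1 (c y)).exists_equiv (Fintype.card_fin _) 0
  choose s hs0 hs using htour
  refine ⟨fun y => s y, fun y hy0 hy1 => ⟨hs0 y, ?_, (s y).injective, fun k hk => ?_⟩,
    fun y z hy0 _ hz0 _ hyz k l hkl h => ?_⟩
  · have := hs y 0
    rwa [zero_add, hs0, hc y hy0, eq_comm] at this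
  · dsimp only at hk
    -- An arc `u → u + 1` already lies in cycle `0`, which would force `c y = 0` and hence `y = 1`.
    rw [← hs, ← hg0] at hk
    have := hg.2 _ hk
    have h0 := hc y hy0
    rw [this, hg0, zero_add] at h0
    exact hy1 h0.symm
  · dsimp only at hkl h
    rw [← hs, ← hs, hkl] at h
    have := hg.2 _ h
    exact hyz (by rw [← hc y hy0, ← hc z hz0, this])

/-- The tour starting `0, 2` cannot continue with `3`, so it is `0, 2, 1, 3`; its closing arc `3 →
0` belongs to the normalized cycle. -/
theorem not_isCyclicFactorization_four (f : Fin 3 → Fin 4 → Fin 4) :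
    ¬ IsCyclicFactorization f := by
  intro hf
  obtain ⟨s, hs, -⟩ := hf.exists_tours
  obtain ⟨h0, h1, h2, h3⟩ := hs 2 (by decide) (by decide)
  have h : s 2 = ![0, 2, s 2 2, s 2 3] := by
    ext k
    fin_cases k <;> simp [h0, h1]
  rw [h] at h2 h3
  have key : ∀ a b : Fin 4, Function.Injective ![0, 2, a, b] →
      ¬ ∀ k : Fin 4, ![0, 2, a, b] (k + 1) ≠ ![0, 2, a, b] k + 1 := by decide
  exact key _ _ h2 h3

theorem Nat.beq_eq_false_iff {a b : ℕ} : Nat.beq a b = false ↔ a ≠ b := by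
  rw [← Bool.not_eq_true, Nat.beq_eq]

/-- The arcs of a closed tour of `Fin 6`, the arc `uv` being coded as `6 * u + v`. -/
def tourArcs (s : Fin 6 → Fin 6) : List ℕ :=
  (List.finRange 6).map fun k => 6 * (s k).val + (s (k + 1)).val

/-- Whether two lists have no common entry. -/
def noCommon (l m : List ℕ) : Bool := l.all fun x => m.all fun y => !Nat.beq x y

/-- The nonzero vertices outside `used` which may follow `u`. -/
def nextVertices (used : List ℕ) (u : ℕ) : List ℕ :=
  [1, 2, 3, 4, 5].filter fun x => !Nat.beq x (u + 1) && used.all fun y => !Nat.beq x y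

/-- The arc lists of the tours `0, y, …` of `Fin 6` in which no `u` is followed by `u + 1`. -/
def tours (y : ℕ) : List (List ℕ) :=
  (nextVertices [y] y).flatMap fun a => (nextVertices [y, a] a).flatMap fun b =>
    (nextVertices [y, a, b] b).flatMap fun c =>
      ((nextVertices [y, a, b, c] c).filter fun d => !Nat.beq d 5).map fun d =>
        [y, 6 * y + a, 6 * a + b, 6 * b + c, 6 * c + d, 6 * d]

theorem noCommon_tourArcs {s t : Fin 6 → Fin 6}
    (h : ∀ k l, s k = t l → s (k + 1) ≠ t (l + 1)) :
    noCommon (tourArcs s) (tourArcs t) = true := by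
  simp only [noCommon, tourArcs, List.all_eq_true, List.mem_map, List.mem_finRange, true_and,
    forall_exists_index, forall_apply_eq_imp_iff, Bool.not_eq_true', Nat.beq_eq_false_iff]
  intro k l hkl
  have h1 := (s (k + 1)).2
  have h2 := (t (l + 1)).2
  exact h k l (Fin.ext (by omega)) (Fin.ext (by omega))

theorem mem_nextVertices {used : List ℕ} {u : ℕ} {x : Fin 6} (h0 : x ≠ 0) (hu : x.val ≠ u + 1)
    (h : ∀ y ∈ used, x.val ≠ y) : x.val ∈ nextVertices used u := by
  simp only [nextVertices, List.mem_filter, Bool.and_eq_true, List.all_eq_true, Bool.not_eq_true',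
    Nat.beq_eq_false_iff]
  have hmem : ∀ x : Fin 6, x ≠ 0 → x.val ∈ [1, 2, 3, 4, 5] := by decide
  exact ⟨hmem x h0, hu, h⟩

theorem tourArcs_mem_tours {s : Fin 6 → Fin 6} (h0 : s 0 = 0) (hs : Function.Injective s)
    (hsucc : ∀ k, s (k + 1) ≠ s k + 1) : tourArcs s ∈ tours (s 1).val := by
  have hne : ∀ i j, i ≠ j → (s i).val ≠ (s j).val :=
    fun i j hij h => hij (hs (Fin.ext h))
  have hne0 : ∀ i, i ≠ 0 → s i ≠ 0 := fun i hi h => hi (hs (h.trans h0.symm))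
  have hval : ∀ x y : Fin 6, x ≠ y + 1 → x.val ≠ y.val + 1 := by decide
  -- In `Fin 6` the successor of `5` is `0`, so the closing arc may not start at `5`.
  have hlast : ∀ x : Fin 6, 0 ≠ x + 1 → x.val ≠ 5 := by decide
  have harcs : tourArcs s = [(s 1).val, 6 * (s 1).val + (s 2).val, 6 * (s 2).val + (s 3).val,
      6 * (s 3).val + (s 4).val, 6 * (s 4).val + (s 5).val, 6 * (s 5).val] := by
    have : tourArcs s = [6 * (s 0).val + (s 1).val, 6 * (s 1).val + (s 2).val,
      6 * (s 2).val + (s 3).val, 6 * (s 3).val + (s 4).val, 6 * (s 4).val + (s 5).val,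
      6 * (s 5).val + (s 0).val] := rfl
    rw [this, h0]
    simp
  simp only [tours, List.mem_flatMap, List.mem_map, List.mem_filter, Bool.not_eq_true',
    Nat.beq_eq_false_iff]
  refine ⟨(s 2).val, mem_nextVertices (hne0 2 (by decide)) (hval _ _ (hsucc 1)) ?_,
    (s 3).val, mem_nextVertices (hne0 3 (by decide)) (hval _ _ (hsucc 2)) ?_,
    (s 4).val, mem_nextVertices (hne0 4 (by decide)) (hval _ _ (hsucc 3)) ?_,
    (s 5).val, ⟨mem_nextVertices (hne0 5 (by decide)) (hval _ _ (hsucc 4)) ?_,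
      hlast _ (h0 ▸ hsucc 5)⟩, harcs.symm⟩ <;>
    simp only [List.forall_mem_cons, List.not_mem_nil, false_imp_iff, implies_true, and_true]
  · exact hne _ _ (by decide)
  · exact ⟨hne _ _ (by decide), hne _ _ (by decide)⟩
  · exact ⟨hne _ _ (by decide), hne _ _ (by decide), hne _ _ (by decide)⟩
  · exact ⟨hne _ _ (by decide), hne _ _ (by decide), hne _ _ (by decide), hne _ _ (by decide)⟩

/-- Exhaustive search for four disjoint tours with second vertices `2, 3, 4, 5`; a branch is
abandoned once the newest tour meets an earlier one. -/
theorem tours_incompatible :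
    ((tours 2).all fun s => (tours 3).all fun t => !noCommon s t ||
      (tours 4).all fun u => !(noCommon s u && noCommon t u) ||
        (tours 5).all fun v => !(noCommon s v && noCommon t v && noCommon u v)) = true := by
  decide +kernel

theorem not_isCyclicFactorization_six (f : Fin 5 → Fin 6 → Fin 6) :
    ¬ IsCyclicFactorization f := by
  intro hf
  obtain ⟨s, hs, hd⟩ := hf.exists_tours
  have hmem : ∀ y, y ≠ 0 → y ≠ 1 → tourArcs (s y) ∈ tours y.val := by
    intro y hy0 hy1
    obtain ⟨h0, h1, h2, h3⟩ := hs y hy0 hy1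
    simpa only [h1] using tourArcs_mem_tours h0 h2 h3
  have hnc : ∀ y z : Fin 6, y ≠ 0 ∧ y ≠ 1 ∧ z ≠ 0 ∧ z ≠ 1 ∧ y ≠ z →
      noCommon (tourArcs (s y)) (tourArcs (s z)) = true := fun y z ⟨h1, h2, h3, h4, h5⟩ =>
    noCommon_tourArcs (hd y z h1 h2 h3 h4 h5)
  have h := tours_incompatible
  rw [List.all_eq_true] at h
  have h := h _ (hmem 2 (by decide) (by decide))
  rw [List.all_eq_true] at h
  have h := h _ (hmem 3 (by decide) (by decide))
  rw [hnc 2 3 (by decide), Bool.not_true, Bool.false_or, List.all_eq_true] at h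
  have h := h _ (hmem 4 (by decide) (by decide))
  rw [hnc 2 4 (by decide), hnc 3 4 (by decide), Bool.and_true, Bool.not_true, Bool.false_or,
    List.all_eq_true] at h
  have h := h _ (hmem 5 (by decide) (by decide))
  rw [hnc 2 5 (by decide), hnc 3 5 (by decide), hnc 4 5 (by decide)] at h
  exact absurd h (by decide)

/-! ### The values for each `n` and `k` -/

namespace Digraph

theorem hasArcDisjointStrong_of_odd {n : ℕ} (h3 : 3 ≤ n) (hn : n % 2 = 1) (S : Finset (Fin n)) :
    (symmComplete (Fin n)).HasArcDisjointStrong S (n - 1) := by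
  have hm : n / 2 ≠ 0 := by omega
  have : NeZero (2 * (n / 2)) := ⟨by omega⟩
  have e : Option (ZMod (2 * (n / 2))) ≃ Fin n := Fintype.equivOfCardEq (by
    rw [Fintype.card_option, ZMod.card, Fintype.card_fin]; omega)
  have := hasArcDisjointStrong_of_factorization e (isCyclicFactorization_evenZigzag hm) S
  rwa [ZMod.card, show 2 * (n / 2) = n - 1 by omega] at this

theorem hasArcDisjointStrong_of_even {n : ℕ} (h8 : 8 ≤ n) (hn : n % 2 = 0) (S : Finset (Fin n)) :
    (symmComplete (Fin n)).HasArcDisjointStrong S (n - 1) := by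
  obtain ⟨M, rfl⟩ : ∃ M, n = 2 * M + 2 := ⟨n / 2 - 1, by omega⟩
  have e : Option (ZMod (2 * M + 1)) ≃ Fin (2 * M + 2) := Fintype.equivOfCardEq (by
    rw [Fintype.card_option, ZMod.card, Fintype.card_fin])
  have := hasArcDisjointStrong_of_factorization e
    (isCyclicFactorization_tillson (M := M) (by omega)) S
  convert this using 1
  simp only [Fintype.card_sum, Fintype.card_prod, Fintype.card_fin, Fintype.card_bool]
  omega

theorem hasArcDisjointStrong_sub_two {n : ℕ} (h4 : 4 ≤ n) (hn : n % 2 = 0) (S : Finset (Fin n)) :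
    (symmComplete (Fin n)).HasArcDisjointStrong S (n - 2) := by
  obtain ⟨M, rfl⟩ : ∃ M, n = 2 * M + 2 := ⟨n / 2 - 1, by omega⟩
  have e : Option (ZMod (2 * M + 1)) ≃ Fin (2 * M + 2) := Fintype.equivOfCardEq (by
    rw [Fintype.card_option, ZMod.card, Fintype.card_fin])
  have := hasArcDisjointStrong_of_factorization e (isCyclicFactorization_rotatedZigzag M) S
  convert this using 1
  simp only [Fintype.card_prod, Fintype.card_fin, Fintype.card_bool]
  omega

theorem hasArcDisjointStrong_of_even_of_notMem {n : ℕ} (h4 : 4 ≤ n) (hn : n % 2 = 0)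
    {S : Finset (Fin n)} {v : Fin n} (hv : v ∉ S) :
    (symmComplete (Fin n)).HasArcDisjointStrong S (n - 1) := by
  obtain ⟨m, rfl⟩ : ∃ m, n = 2 * m + 2 := ⟨n / 2 - 1, by omega⟩
  have hm : m ≠ 0 := by omega
  have : NeZero (2 * m) := ⟨by omega⟩
  have e : Option (ZMod (2 * m)) ≃ {x : Fin (2 * m + 2) // x ≠ v} := Fintype.equivOfCardEq (by
    rw [Fintype.card_option, ZMod.card]; simp)
  have := hasArcDisjointStrong_succ_of_factorization e (isCyclicFactorization_evenZigzag hm) hv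
  rwa [ZMod.card] at this

theorem hasArcDisjointStrong_two (S : Finset (Fin 2)) :
    (symmComplete (Fin 2)).HasArcDisjointStrong S 1 :=
  ⟨fun _ => starSubdigraph 0, fun _ => ⟨starSubdigraph_strong 0, fun _ _ => Set.mem_univ _⟩,
    fun i j hij => absurd (Subsingleton.elim i j) hij⟩

end Digraph

theorem lemma2 (n k : ℕ) (hk : 2 ≤ k) (hkn : k ≤ n) :
    ((k ∉ ({4, 6} : Finset ℕ) ∨ (k ∈ ({4, 6} : Finset ℕ) ∧ k < n)) →
      (Digraph.symmComplete (Fin n)).strongArcConn k = ((n - 1 : ℕ) : ℕ∞)) ∧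
    ((k = n ∧ n ∈ ({4, 6} : Finset ℕ)) →
      (Digraph.symmComplete (Fin n)).strongArcConn k = ((n - 2 : ℕ) : ℕ∞)) := by
  have hupper : ∀ S : Finset (Fin n), S.card = k → ∀ q,
      (Digraph.symmComplete (Fin n)).HasArcDisjointStrong S q → q ≤ n - 1 := by
    intro S hS q hq
    simpa using hq.le_card_sub_one (by omega)
  refine ⟨fun h => Digraph.strongArcConn_eq (by simpa using hkn) (fun S hS => ?_) hupper,
    fun h => Digraph.strongArcConn_eq (by simpa using hkn) (fun S hS => ?_) fun S hS q hq => ?_⟩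
  · simp only [Finset.mem_insert, Finset.mem_singleton] at h
    rcases Nat.mod_two_eq_zero_or_one n with hn | hn
    · by_cases h8 : 8 ≤ n
      · exact Digraph.hasArcDisjointStrong_of_even h8 hn S
      · by_cases h2 : n = 2
        · subst h2
          exact Digraph.hasArcDisjointStrong_two S
        · have hlt : k < n := by omega
          obtain ⟨v, hv⟩ : ∃ v, v ∉ S := by
            by_contra hall
            push Not at hall
            rw [Finset.eq_univ_iff_forall.2 hall, Finset.card_univ, Fintype.card_fin] at hS
            omega
          exact Digraph.hasArcDisjointStrong_of_even_of_notMem (by omega) hn hv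
    · exact Digraph.hasArcDisjointStrong_of_odd (by omega) hn S
  · simp only [Finset.mem_insert, Finset.mem_singleton] at h
    exact Digraph.hasArcDisjointStrong_sub_two (by omega) (by omega) S
  · have hq1 := hupper S hS q hq
    obtain ⟨rfl, h⟩ := h
    obtain rfl : S = Finset.univ := by
      rw [← Finset.card_eq_iff_eq_univ, hS, Fintype.card_fin]
    by_contra hlt
    -- With `k = n`, exceeding `n - 2` means attaining `n - 1`, that is, a full hamiltonian
    -- decomposition.
    obtain rfl : q = k - 1 := by omega
    simp only [Finset.mem_insert, Finset.mem_singleton] at h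
    rcases h with rfl | rfl
    · obtain ⟨f, hf⟩ := hq.exists_factorization (by simp)
      exact not_isCyclicFactorization_four f hf
    · obtain ⟨f, hf⟩ := hq.exists_factorization (by simp)
      exact not_isCyclicFactorization_six f hf
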